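/- **Setting.** Let $D$ be a finite abelian group and $q:D\to\mathbb{Q}/\mathbb{Z}$ a quadratic form whose bilinear form $b_q(x,y)=q(x+y)-q(x)-q(y)$ is non-degenerate. Let $\mathfrak{L}\subset D$ be a Lagrangian subgroup, i.e. $q|_{\mathfrak{L}}=0$ and $\mathfrak{L}^{\perp}\subseteq\mathfrak{L}$ (orthogonal complement for $b_q$). Write $I(D)$ for the minimal number of generators of $D$, and $H^*=\mathrm{Hom}(H,\mathbb{Q}/\mathbb{Z})$. Consider pairs $(A,\ell)$ of a finitely generated abelian group $A$ and a non-degenerate symmetric bilinear form $\ell:\mathrm{Tor}\,A\times\mathrm{Tor}\,A\to\mathbb{Q}/\mathbb{Z}$. Two pairs are equivalent if some isomorphism of groups carries one form to the other; fix a representative of each equivalence class. Let $a(n)$ be the number of classes of pairs with $A$ finite of order $n$, and $\Xi(s)=\sum_{n\ge1}a(n)n^{-s}$. For $f\in A^k\cong\mathrm{Hom}(\mathbb{Z}^k,A)$, a *surgery presentation* of $(A,\ell,f)$ consists of a symmetric integer matrix $\begin{pmatrix}J&F\\F^T&J'\end{pmatrix}$ with blocks of sizes $m$ and $k$, and a surjection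 $p:\mathbb{Z}^m\to A$ with kernel $J\mathbb{Z}^m$, such that $\ell$ is induced by $J^{-1}$ (i.e. $\ell(p(x),p(y))=(u\cdot y)/n \bmod 1$ whenever $p(x),p(y)\in\mathrm{Tor}\,A$, $n\neq 0$ and $Ju=nx$) and $f=p\circ F$. For $c\in\mathfrak{L}^k$ let $$Z(A,\ell,f;D,q;c)=|D|^{-\frac{m+1}{2}}\sum_{x\in D^m}\exp\bigl[-2\pi i\bigl((J\otimes q)(x)+(F\otimes b_q)(x,c)+(J'\otimes q)(c)\bigr)\bigr],$$ where $(J\otimes q)(x)=\sum_iJ_{ii}q(x_i)+\sum_{i<j}J_{ij}b_q(x_i,x_j)$ (similarly for $J'$) and $(F\otimes b_q)(x,c)=\sum_{i,j}F_{ij}b_q(x_i,c_j)$, computed from a surgery presentation of $(A,\ell,f)$. Let $g\ge0$. Let $\mu(A,\ell,f)\ge0$ be real numbers given for all representatives $(A,\ell)$ and all $f\in A^g$, put $\mu(A,\ell,A^g)=\sum_{f\in A^g}\mu(A,\ell,f)$, and $$\mathcal{Z}_g(D,q;\mathfrak{L};\mu)=\sum_{(A,\ell)}\ \sum_{f\in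 A^g}\mu(A,\ell,f)\sum_{c\in\mathfrak{L}^g}Z(A,\ell,f;D,q;c).$$ **Theorem.** Suppose that for some $C>0$, $0\le\lambda<|D|^{-1/2}$ and $s>I(D)+1$ one has $\mu(A,\ell,A^g)\le C\,\lambda^{\mathrm{rank}\,A}\,|\mathrm{Tor}\,A|^{-s}$ for all $(A,\ell)$. 1. For $c\in\mathfrak{L}^k$ the number $Z(A,\ell,f;D,q;c)$ does not depend on the surgery presentation of $(A,\ell,f)$, and depends on $(f,c)$ only through $\theta=\sum_i c_i\otimes f_i\in\mathfrak{L}\otimes A$; write it as $Z(A,\ell;D,q;\theta)$. 2. The series $\Xi(s-I(D))$ converges, the sum over all triples $(A,\ell,f)$ defining $\mathcal{Z}_g$ converges absolutely, and $$|\mathcal{Z}_g(D,q;\mathfrak{L};\mu)|\le\frac{C\,|D|^{\frac{g-1}{2}}}{1-\lambda|D|^{\frac12}}\ \Xi(s-I(D)).$$ 3. Suppose moreover that $\mu(A,\ell,f)=\mu(A,\ell)\prod_{i=1}^g\nu(A,\ell,f_i)$ with real $\mu(A,\ell)$ and $\nu(A,\ell,\phi)$, where for every subset $S\subseteq A$ the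 sum $\nu(A,\ell,S)=\sum_{\phi\in S}\nu(A,\ell,\phi)$ converges to an element of $\mathbb{Z}_{\ge0}$. Put $$b_n=\sum_{(A,\ell)}\frac{\mu(A,\ell)}{|\mathfrak{L}\otimes A|}\ \sum_{\theta\in\mathfrak{L}\otimes\mathrm{Tor}\,A}\ \sum_{\substack{\alpha\in\mathrm{Hom}(A,\mathfrak{L}^*)\\ \nu(A,\ell,\ker\alpha)\,|\mathfrak{L}|=n}}Z(A,\ell;D,q;\theta)\,e^{2\pi i\alpha(\theta)},$$ an expression that does not involve $g$. Then the series for $b_n$ converges absolutely for every $n\ge1$, $b_n=0$ unless $|\mathfrak{L}|$ divides $n$, and if $g\ge1$, or if $\nu(A,\ell,\ker\alpha)\neq0$ for all $(A,\ell)$ and all $\alpha\in\mathrm{Hom}(A,\mathfrak{L}^*)$, then $$\mathcal{Z}_g(D,q;\mathfrak{L};\mu)=\sum_{n=1}^{\infty}b_n\,n^g,$$ the series being absolutely convergent. For every $g\ge0$ the same identity holds with the sum starting at $n=0$, with the convention $0^0=1$ (for $g\ge1$ the term $n=0$ is read as $0$). -/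

import Mathlib

open scoped TensorProduct NNReal ENNReal Matrix

noncomputable section

namespace AbelianTQFT

/-- The group `ℚ/ℤ`. -/
abbrev QZ : Type := AddCircle (1 : ℚ)

/-- The character `x ↦ exp(2πi x)` of `ℚ/ℤ`. -/
def e (x : QZ) : ℂ :=
  Function.Periodic.lift (f := fun r : ℚ => Complex.exp (2 * Real.pi * Complex.I * (r : ℂ)))
    (c := (1 : ℚ))
    (fun r => by
      have h : (2 * Real.pi * Complex.I * ((r + 1 : ℚ) : ℂ) : ℂ)
          = 2 * Real.pi * Complex.I * (r : ℂ) + 2 * Real.pi * Complex.I := by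
        push_cast
        ring
      simp only [h, Complex.exp_periodic _]) x

section Theory

variable {D : Type*} [AddCommGroup D]

/-- The bilinear form `b_q(x,y) = q(x+y) - q(x) - q(y)` has trivial radical. -/
def IsNondegenerate (q : QuadraticMap ℤ D QZ) : Prop :=
  ∀ x : D, (∀ y : D, QuadraticMap.polar q x y = 0) → x = 0

/-- A Lagrangian subgroup of `(D,q)`: `q` vanishes on it, so that it is isotropic for `b_q`, and it
contains its own `b_q`-orthogonal complement. -/
structure IsLagrangian (q : QuadraticMap ℤ D QZ) (Lag : AddSubgroup D) : Prop where
  isotropic : ∀ x ∈ Lag, q x = 0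
  coisotropic : ∀ x : D, (∀ y ∈ Lag, QuadraticMap.polar q x y = 0) → x ∈ Lag

/-- The quadratic form `L ⊗ q` on `ℤ^m ⊗ D = D^m`, for a symmetric integer matrix `L`. -/
def tensorQuad (q : QuadraticMap ℤ D QZ) {m : ℕ} (L : Matrix (Fin m) (Fin m) ℤ)
    (x : Fin m → D) : QZ :=
  ∑ i, L i i • q (x i) + ∑ i, ∑ j ∈ Finset.Ioi i, L i j • QuadraticMap.polar q (x i) (x j)

end Theory

/-- A pair `(A, ℓ)`: a finitely generated abelian group `A` with a nondegenerate symmetric bilinear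
form `ℓ : Tor A × Tor A → ℚ/ℤ`. -/
structure LinkingPair where
  carrier : Type
  [addCommGroup : AddCommGroup carrier]
  [finite : Module.Finite ℤ carrier]
  form : Submodule.torsion ℤ carrier →ₗ[ℤ] Submodule.torsion ℤ carrier →ₗ[ℤ] QZ
  symm : ∀ x y, form x y = form y x
  nondegenerate : ∀ x, (∀ y, form x y = 0) → x = 0

instance : CoeSort LinkingPair Type := ⟨LinkingPair.carrier⟩

attribute [instance] LinkingPair.addCommGroup LinkingPair.finite

/-- The torsion subgroup `Tor A`. -/
abbrev LinkingPair.Tor (X : LinkingPair) : Submodule ℤ X := Submodule.torsion ℤ X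

/-- The rank of `A`. -/
def LinkingPair.rank (X : LinkingPair) : ℕ := Module.finrank ℤ X

/-- `(A,ℓ) ∼ (A',ℓ')`: there is an isomorphism `A ≅ A'` carrying `ℓ` to `ℓ'`. -/
def LinkingPair.Equivalent (X Y : LinkingPair) : Prop :=
  ∃ φ : X ≃+ Y, ∀ (x y : X.Tor) (x' y' : Y.Tor), φ x = x' → φ y = y' →
    X.form x y = Y.form x' y'

theorem LinkingPair.map_mem_torsion {X Y : LinkingPair} (φ : X ≃+ Y) (x : X.Tor) :
    φ x ∈ Y.Tor := by
  obtain ⟨a, ha⟩ := (Submodule.mem_torsion_iff (x : X)).1 x.2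
  refine (Submodule.mem_torsion_iff _).2 ⟨a, ?_⟩
  have h : (a : ℤ) • (x : X) = 0 := ha
  change (a : ℤ) • φ x = 0
  rw [← map_zsmul, h, map_zero]

instance LinkingPair.setoid : Setoid LinkingPair where
  r := LinkingPair.Equivalent
  iseqv :=
    { refl := fun X => ⟨AddEquiv.refl X, fun x y x' y' hx hy => by
        obtain rfl : x = x' := Subtype.ext hx
        obtain rfl : y = y' := Subtype.ext hy
        rfl⟩
      symm := fun {X Y} ⟨φ, h⟩ => ⟨φ.symm, fun x y x' y' hx hy =>
        (h x' y' x y (by rw [← hx]; simp) (by rw [← hy]; simp)).symm⟩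
      trans := fun {X Y Z} ⟨φ, h⟩ ⟨ψ, k⟩ => ⟨φ.trans ψ, fun x y x' y' hx hy =>
        (h x y ⟨φ x, map_mem_torsion φ x⟩ ⟨φ y, map_mem_torsion φ y⟩ rfl rfl).trans
          (k _ _ x' y' hx hy)⟩ }

/-- Equivalence classes of pairs `(A, ℓ)`. -/
abbrev PairClass : Type 1 := Quotient LinkingPair.setoid

/-- `a(n)`: the number of classes of pairs `(A, ℓ)` with `A` finite of order `n`. -/
def formCount (n : ℕ) : ℕ :=
  Nat.card {P : PairClass // ∃ X : LinkingPair, (⟦X⟧ : PairClass) = P ∧ Finite X ∧ Nat.card X = n}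

/-- The terms of the Dirichlet series `Ξ(s) = ∑_{n ≥ 1} a(n) n^{-s}`, for real `s`. -/
def XiTerm (s : ℝ) (n : ℕ+) : ℝ := (formCount n : ℝ) * ((n : ℕ) : ℝ) ^ (-s)

/-- `Ξ(s)`, for real `s`. -/
def Xi (s : ℝ) : ℝ := ∑' n : ℕ+, XiTerm s n

/-- A surgery presentation of a triple `(A, ℓ, f)`, with `f` an element of `A^k = Hom(ℤ^k, A)`.
It consists of the blocks of the linking matrix `((J, F), (Fᵀ, J'))` of a framed link in the
3-sphere. The first `m` components are the surgery link and the last `k` components become the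
link whose homology classes are the `f i`: the projection `proj` identifies the cokernel of `J`
with `A`, the form `ℓ` is the one induced by the inverse of `J` (if `J u = n x` then
`ℓ([x],[y]) = (u · y) / n`), and `f` is the composition of `proj` and `F`. -/
structure SurgeryPresentation (X : LinkingPair) {k : ℕ} (f : Fin k → X) where
  m : ℕ
  J : Matrix (Fin m) (Fin m) ℤ
  F : Matrix (Fin m) (Fin k) ℤ
  J' : Matrix (Fin k) (Fin k) ℤ
  J_symm : J.IsSymm
  J'_symm : J'.IsSymm
  proj : (Fin m → ℤ) →ₗ[ℤ] X
  proj_surjective : Function.Surjective proj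
  ker_proj : LinearMap.ker proj = LinearMap.range J.mulVecLin
  linking : ∀ (x y u : Fin m → ℤ) (hx : proj x ∈ X.Tor) (hy : proj y ∈ X.Tor) (n : ℤ), n ≠ 0 →
    J *ᵥ u = n • x → X.form ⟨proj x, hx⟩ ⟨proj y, hy⟩ = (((u ⬝ᵥ y : ℤ) : ℚ) / (n : ℚ) : ℚ)
  proj_F : ∀ i, proj (fun a => F a i) = f i

section PartitionFunction

variable {D : Type*} [AddCommGroup D]

/-- The surgery formula
`|D|^{-(m+1)/2} ∑_{x ∈ D^m} exp(-2πi ((J ⊗ q)(x) + (F ⊗ b_q)(x,c) + (J' ⊗ q)(c)))`. -/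
def SurgeryPresentation.value (q : QuadraticMap ℤ D QZ) {X : LinkingPair} {k : ℕ} {f : Fin k → X}
    (S : SurgeryPresentation X f) (c : Fin k → D) : ℂ :=
  (((Nat.card D : ℝ) ^ (-((S.m : ℝ) + 1) / 2) : ℝ) : ℂ) *
    ∑ᶠ x : Fin S.m → D,
      e (-(tensorQuad q S.J x + ∑ a, ∑ i, S.F a i • QuadraticMap.polar q (x a) (c i)
        + tensorQuad q S.J' c))

open Classical in
/-- The partition function `Z(A, ℓ, f; D, q; c)`, for labels `c` in a Lagrangian subgroup: the
value of the surgery formula on a surgery presentation of `(A, ℓ, f)`. -/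
def partitionFunction (q : QuadraticMap ℤ D QZ) (Lag : AddSubgroup D) (X : LinkingPair) {k : ℕ}
    (f : Fin k → X) (c : Fin k → Lag) : ℂ :=
  if h : Nonempty (SurgeryPresentation X f) then h.some.value q (fun i => (c i : D)) else 0

theorem exists_tensor_eq_sum (Lag : AddSubgroup D) (X : LinkingPair) (θ : Lag ⊗[ℤ] X) :
    ∃ t : (k : ℕ) × ((Fin k → X) × (Fin k → Lag)), ∑ i, t.2.2 i ⊗ₜ[ℤ] t.2.1 i = θ := by
  induction θ using TensorProduct.induction_on with
  | zero => exact ⟨⟨0, Fin.elim0, Fin.elim0⟩, by simp⟩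
  | tmul c a => exact ⟨⟨1, fun _ => a, fun _ => c⟩, by simp⟩
  | add x y hx hy =>
    obtain ⟨⟨k, f, c⟩, rfl⟩ := hx
    obtain ⟨⟨l, f', c'⟩, rfl⟩ := hy
    exact ⟨⟨k + l, Fin.append f f', Fin.append c c'⟩, by simp [Fin.sum_univ_add]⟩

/-- The partition function as a function `Z(A, ℓ; D, q; θ)` of the class
`θ = ∑ c_i ⊗ f_i` in `𝔏 ⊗ A`. -/
def thetaPartitionFunction (q : QuadraticMap ℤ D QZ) (Lag : AddSubgroup D) (X : LinkingPair)
    (θ : Lag ⊗[ℤ] X) : ℂ :=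
  partitionFunction q Lag X (exists_tensor_eq_sum Lag X θ).choose.2.1
    (exists_tensor_eq_sum Lag X θ).choose.2.2

/-- The contribution `μ(A,ℓ,f) ∑_{c ∈ 𝔏^g} Z(A,ℓ,f;D,q;c)` of a triple, where `w = μ(A,ℓ,f)`. -/
def summand (q : QuadraticMap ℤ D QZ) (Lag : AddSubgroup D) {g : ℕ} (X : LinkingPair)
    (f : Fin g → X) (w : ℝ≥0) : ℂ :=
  ((w : ℝ) : ℂ) * ∑ᶠ c : Fin g → Lag, partitionFunction q Lag X f c

/-- The connected gravitational partition function `𝒵_g(D,q;𝔏;μ)`; `rep` is a system of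
representatives for the classes of pairs `(A, ℓ)`. -/
def connectedZ (q : QuadraticMap ℤ D QZ) (Lag : AddSubgroup D) (g : ℕ)
    (rep : PairClass → LinkingPair) (μ : (P : PairClass) → (Fin g → rep P) → ℝ≥0) : ℂ :=
  ∑' P : PairClass, ∑' f : Fin g → rep P, summand q Lag (rep P) f (μ P f)

/-- The contribution of `(A, ℓ)` to the coefficient `b_n`:
`μ₀ / |𝔏 ⊗ A| ∑_θ ∑_α Z(A,ℓ;D,q;θ) exp(2πi α(θ))`, with `θ` in `𝔏 ⊗ Tor A` and `α` in
`Hom(A, 𝔏^*)` such that `ν(ker α) |𝔏| = n`. -/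
def dirichletTerm (q : QuadraticMap ℤ D QZ) (Lag : AddSubgroup D) (X : LinkingPair)
    (μ₀ : ℝ) (ν : X → ℝ) (n : ℕ) : ℂ :=
  ((μ₀ / Nat.card (Lag ⊗[ℤ] X) : ℝ) : ℂ) *
    ∑ᶠ (θ : Lag ⊗[ℤ] X.Tor),
      ∑ᶠ (α : X →ₗ[ℤ] (Lag →ₗ[ℤ] QZ))
        (_ : (∑' φ : LinearMap.ker α, ν φ) * (Nat.card Lag : ℝ) = (n : ℝ)),
        thetaPartitionFunction q Lag X (X.Tor.subtype.lTensor Lag θ) *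
          e (TensorProduct.lift α.flip (X.Tor.subtype.lTensor Lag θ))

/-- The coefficient `b_n`. -/
def dirichletCoeff (q : QuadraticMap ℤ D QZ) (Lag : AddSubgroup D)
    (rep : PairClass → LinkingPair) (μ₀ : PairClass → ℝ) (ν : (P : PairClass) → rep P → ℝ)
    (n : ℕ) : ℂ :=
  ∑' P : PairClass, dirichletTerm q Lag (rep P) (μ₀ P) (ν P) n

end PartitionFunction

end AbelianTQFT

end

/-!
The whole theorem follows from a finite Fourier expansion of the partition function
(`SurgeryPresentation.value_eq`). Since `𝔏` is Lagrangian, `b_q` identifies `D/𝔏` with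
`𝔏^* = Hom(𝔏, ℚ/ℤ)`, and `|D| = |𝔏|²`. In the surgery formula, first sum over the cosets of `𝔏^m`
in `D^m`. On a coset, the exponent is a character of `𝔏^m` up to a constant, and the character is
trivial exactly when `J` annihilates the corresponding vector of `(𝔏^*)^m`; as `A` is the cokernel
of `J`, such vectors are the homomorphisms `β : A → 𝔏^*`. Hence

  `Z(A, ℓ, f; c) = |𝔏|⁻¹ ∑_β Φ(β) exp(-2πi ∑_i β(f_i)(c_i))`,

where `Φ(β) = exp(-2πi (J ⊗ q)(y))` for a lift `y` of `β` to `D^m`.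

* The phases do not depend on the presentation (`SurgeryPresentation.phase_congr`). A lift `T` of
  the identity of `A` to the two lattices satisfies `J₂ - T J₁ Tᵀ = J₂ G J₂` for a symmetric integer
  matrix `G`, because both presentations induce the same nondegenerate form on `Tor A`
  (`SurgeryPresentation.exists_conj`), and `J₂` maps a lift of `β` into `𝔏^m`, where
  `G ⊗ q` vanishes. The expansion involves `f` and `c` only through `∑ c_i ⊗ f_i`. Moreover `Φ(β)`
  only depends on the restriction of `β` to `Tor A`.

  If `(A, ℓ)` has no surgery presentation, the partition function is zero by definition, and the
  expansion holds with `Φ = 0`; so the existence of surgery presentations plays no role.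

* The expansion gives `|Z| ≤ |𝔏|⁻¹ |Hom(A, 𝔏^*)|`, and `|Hom(A, 𝔏^*)|` is at most
  `|𝔏|^rank A |Tor A|^I(D)` (`card_hom_le`). As a class `(A, ℓ)` is determined by the rank of `A`
  and the class of the form on `Tor A`, the sum over all classes is dominated by a geometric series of
  ratio `λ |𝔏| = λ |D|^{1/2} < 1` times `Ξ(s - I(D))` (`summable_pairClass`).

* `Ξ(σ)` converges for `σ > 1` (`summable_finiteClass`). A nondegenerate form on a finite group is
  an orthogonal sum of blocks: cyclic groups of prime power order and groups `(ℤ/2^k)²`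
  (`exists_hasBlocks`). The multiset of the types of the blocks determines the form, so the series
  is bounded by the Euler product `∏ (1 - |block|^{-σ})⁻¹` over all types of blocks. The number of
  types is small enough for its convergence: two for each order, and at most `2^k` and `4^k` for
  the further blocks of orders `2^k` and `4^k`.

* For a product weight, summing the expansion over `c` replaces each factor `ν(f_i)` by
  `|𝔏| ν(f_i)` if `β(f_i) = 0` and by zero otherwise, and then summing over `f` gives the power
  `(|𝔏| ν(ker β))^g`. Fourier inversion on `𝔏 ⊗ Tor A` (`sum_theta_eq`) identifies the coefficients
  with those of the theorem, so that the contribution of `(A, ℓ)` is a finite Dirichlet polynomial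
  (`hasSum_dirichletTerm`); absolute convergence permits collecting the terms with the same base.
-/

noncomputable section

namespace AbelianTQFT

/-! ### Characters of finite abelian groups with values in `ℚ/ℤ` -/

theorem e_coe (r : ℚ) : e (r : QZ) = Complex.exp (2 * Real.pi * Complex.I * (r : ℂ)) := rfl

@[simp] theorem e_zero : e 0 = 1 := by
  have := e_coe 0
  simpa using this

theorem e_add (x y : QZ) : e (x + y) = e x * e y := by
  induction x using QuotientAddGroup.induction_on with
  | H r =>
    induction y using QuotientAddGroup.induction_on with
    | H s =>
      change e ((r + s : ℚ) : QZ) = e (r : QZ) * e (s : QZ)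
      rw [e_coe, e_coe, e_coe, ← Complex.exp_add]
      congr 1
      push_cast
      ring

theorem e_eq_one_iff {x : QZ} : e x = 1 ↔ x = 0 := by
  induction x using QuotientAddGroup.induction_on with
  | H r =>
    change e (r : QZ) = 1 ↔ (r : QZ) = 0
    rw [e_coe, Complex.exp_eq_one_iff, AddCircle.coe_eq_zero_iff]
    have h : (2 * Real.pi * Complex.I : ℂ) ≠ 0 := Complex.two_pi_I_ne_zero
    constructor
    · rintro ⟨n, hn⟩
      refine ⟨n, ?_⟩
      rw [mul_comm] at hn
      have := mul_right_cancel₀ h hn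
      have h2 : r = (n : ℚ) := by exact_mod_cast this
      simp [h2]
    · rintro ⟨n, rfl⟩
      refine ⟨n, ?_⟩
      simp [mul_comm]

@[simp] theorem norm_e (x : QZ) : ‖e x‖ = 1 := by
  induction x using QuotientAddGroup.induction_on with
  | H r =>
    rw [e_coe]
    have : (2 * Real.pi * Complex.I * (r : ℂ)) = ((2 * Real.pi * (r : ℝ) : ℝ) : ℂ) * Complex.I := by
      push_cast
      ring
    rw [this, Complex.norm_exp_ofReal_mul_I]

theorem e_ne_zero (x : QZ) : e x ≠ 0 := by
  rw [← norm_ne_zero_iff, norm_e]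
  exact one_ne_zero

theorem e_sum {ι : Type*} (s : Finset ι) (f : ι → QZ) : e (∑ i ∈ s, f i) = ∏ i ∈ s, e (f i) := by
  classical
  induction s using Finset.induction_on with
  | empty => simp
  | insert a s ha ih => rw [Finset.sum_insert ha, Finset.prod_insert ha, e_add, ih]

section Characters

variable {G : Type*} [AddCommGroup G]

/-- The complex additive character `x ↦ exp(2πi h(x))` attached to `h : G → ℚ/ℤ`. -/
def toAddChar (h : G →ₗ[ℤ] QZ) : AddChar G ℂ where
  toFun x := e (h x)
  map_zero_eq_one' := by simp
  map_add_eq_mul' x y := by rw [map_add, e_add]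

theorem toAddChar_injective : Function.Injective (toAddChar (G := G)) := by
  intro h k hk
  ext x
  have h1 : e (h x) = e (k x) := DFunLike.congr_fun hk x
  have h2 : e (h x - k x) = 1 := by
    have h3 : e (h x - k x) * e (k x) = e (k x) := by
      rw [← e_add, sub_add_cancel, h1]
    exact (mul_eq_right₀ (e_ne_zero _)).1 h3
  exact sub_eq_zero.1 (e_eq_one_iff.1 h2)

/-- Characters with values in `ℚ/ℤ` separate points. -/
theorem eq_zero_of_forall_dual {x : G} (h : ∀ χ : G →ₗ[ℤ] QZ, χ x = 0) : x = 0 :=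
  CharacterModule.eq_zero_of_character_apply fun c => h (AddMonoidHom.toIntLinearMap c)

theorem sum_e_eq_zero [Fintype G] {h : G →ₗ[ℤ] QZ} (hh : h ≠ 0) : ∑ x, e (h x) = 0 := by
  refine AddChar.sum_eq_zero_of_ne_one (ψ := toAddChar h) fun h1 => hh ?_
  refine toAddChar_injective ?_
  rw [h1]
  ext x
  simp [toAddChar]

variable [Finite G]

instance finite_dual : Finite (G →ₗ[ℤ] QZ) := by
  cases nonempty_fintype G
  exact Finite.of_injective _ toAddChar_injective

theorem card_dual_le : Nat.card (G →ₗ[ℤ] QZ) ≤ Nat.card G := by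
  cases nonempty_fintype G
  have h := Nat.card_le_card_of_injective _ (toAddChar_injective (G := G))
  rwa [Nat.card_eq_fintype_card (α := AddChar G ℂ), AddChar.card_eq,
    ← Nat.card_eq_fintype_card] at h

theorem card_dual : Nat.card (G →ₗ[ℤ] QZ) = Nat.card G := by
  refine le_antisymm card_dual_le ?_
  have h : Function.Injective
      (LinearMap.flip (LinearMap.id : (G →ₗ[ℤ] QZ) →ₗ[ℤ] (G →ₗ[ℤ] QZ))) := by
    rw [← LinearMap.ker_eq_bot, LinearMap.ker_eq_bot']
    intro x hx
    exact eq_zero_of_forall_dual fun χ => DFunLike.congr_fun hx χ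
  exact (Nat.card_le_card_of_injective _ h).trans card_dual_le

end Characters

section Hom

variable {A E : Type*} [AddCommGroup A] [AddCommGroup E]

theorem finite_linearMap [Module.Finite ℤ A] [Finite E] : Finite (A →ₗ[ℤ] E) := by
  obtain ⟨n, f, hf⟩ := Module.Finite.exists_fin' ℤ A
  refine Finite.of_injective (fun h : A →ₗ[ℤ] E => fun i => h (f (Pi.single i 1))) fun h k hk => ?_
  have h1 : h ∘ₗ f = k ∘ₗ f := by
    refine (Pi.basisFun ℤ (Fin n)).ext fun i => ?_
    simpa using congrFun hk i
  ext a
  obtain ⟨v, rfl⟩ := hf a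
  exact DFunLike.congr_fun h1 v

theorem finite_tensor [Module.Finite ℤ A] [Finite E] : Finite (E ⊗[ℤ] A) := by
  have : Module.Finite ℤ E := Module.Finite.of_finite
  have h : Module.Finite ℤ (E ⊗[ℤ] A) := Module.Finite.tensorProduct ℤ E A
  refine Module.finite_of_fg_torsion (E ⊗[ℤ] A) fun {x} => ?_
  have hE : (Nat.card E : ℤ) ≠ 0 := by exact_mod_cast Nat.card_pos.ne'
  refine ⟨⟨Nat.card E, mem_nonZeroDivisors_of_ne_zero hE⟩, ?_⟩
  change (Nat.card E : ℤ) • x = 0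
  induction x using TensorProduct.induction_on with
  | zero => simp
  | tmul c a =>
    rw [TensorProduct.smul_tmul', natCast_zsmul, card_nsmul_eq_zero', TensorProduct.zero_tmul]
  | add x y hx hy => rw [smul_add, hx, hy, add_zero]

/-- Homomorphisms from `A` to the dual of `E` are the characters of `E ⊗ A`. -/
theorem card_tensor [Module.Finite ℤ A] [Finite E] :
    Nat.card (E ⊗[ℤ] A) = Nat.card (A →ₗ[ℤ] (E →ₗ[ℤ] QZ)) := by
  have := finite_tensor (A := A) (E := E)
  rw [← card_dual (G := E ⊗[ℤ] A)]
  exact Nat.card_congr ((TensorProduct.lift.equiv (.id ℤ) E A QZ).symm.toEquiv.trans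
    (LinearMap.lflip (R₀ := ℤ)).toEquiv)

end Hom

/-! ### The quadratic form `J ⊗ q` -/

theorem sum_sum_eq_diag_add_Ioi {M : Type*} [AddCommMonoid M] {m : ℕ} (f : Fin m → Fin m → M) :
    ∑ i, ∑ j, f i j = ∑ i, f i i + ∑ i, ∑ j ∈ Finset.Ioi i, (f i j + f j i) := by
  have h1 : ∀ i : Fin m, ∑ j, f i j
      = f i i + (∑ j ∈ Finset.Ioi i, f i j + ∑ j ∈ Finset.Iio i, f i j) := by
    intro i
    have hd : Disjoint (Finset.Ioi i) (Finset.Iio i) := by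
      rw [Finset.disjoint_left]
      intro j hj hj'
      simp only [Finset.mem_Ioi, Finset.mem_Iio] at hj hj'
      exact absurd hj (not_lt.2 hj'.le)
    rw [← Finset.sum_union hd, ← Finset.sum_insert (s := Finset.Ioi i ∪ Finset.Iio i) (by simp)]
    refine Finset.sum_congr ?_ fun _ _ => rfl
    ext j
    simp only [Finset.mem_univ, Finset.mem_insert, Finset.mem_union, Finset.mem_Ioi,
      Finset.mem_Iio, true_iff]
    rcases lt_trichotomy i j with h | h | h
    · exact Or.inr (Or.inl h)
    · exact Or.inl h.symm
    · exact Or.inr (Or.inr h)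
  have h2 : ∑ i : Fin m, ∑ j ∈ Finset.Iio i, f i j = ∑ j : Fin m, ∑ i ∈ Finset.Ioi j, f i j :=
    Finset.sum_comm' (by simp)
  simp only [h1, Finset.sum_add_distrib, h2]

section TensorQuad

variable {D : Type*} [AddCommGroup D] (q : QuadraticMap ℤ D QZ)

/-- `J ⊗ q` only depends on the pull-back of `q` along `ℤ^m → D`, through the contraction of `J`
with any (not necessarily symmetric) bilinear form inducing this pull-back. -/
theorem tensorQuad_eq_sum {m : ℕ} {J : Matrix (Fin m) (Fin m) ℤ} (hJ : J.IsSymm) (y : Fin m → D)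
    (B : LinearMap.BilinMap ℤ (Fin m → ℤ) QZ)
    (hB : ∀ v, B v v = q (Fintype.linearCombination ℤ y v)) :
    tensorQuad q J y = ∑ i, ∑ j, J i j • B (Pi.single i 1) (Pi.single j 1) := by
  have hq : ∀ i, q (y i) = B (Pi.single i 1) (Pi.single i 1) := by
    intro i
    rw [hB, Fintype.linearCombination_apply_single, one_smul]
  have hp : ∀ i j, QuadraticMap.polar q (y i) (y j)
      = B (Pi.single i 1) (Pi.single j 1) + B (Pi.single j 1) (Pi.single i 1) := by
    intro i j
    have h := hB (Pi.single i 1 + Pi.single j 1)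
    rw [map_add (Fintype.linearCombination ℤ y), Fintype.linearCombination_apply_single,
      Fintype.linearCombination_apply_single, one_smul, one_smul] at h
    rw [QuadraticMap.polar, ← h, hq, hq]
    simp only [map_add, LinearMap.add_apply]
    abel
  rw [sum_sum_eq_diag_add_Ioi, tensorQuad]
  congr 1
  · simp only [hq]
  · refine Finset.sum_congr rfl fun i _ => Finset.sum_congr rfl fun j _ => ?_
    rw [hp, smul_add, hJ.apply i j]

theorem exists_bilin {m : ℕ} (y : Fin m → D) : ∃ B : LinearMap.BilinMap ℤ (Fin m → ℤ) QZ,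
    ∀ v, B v v = q (Fintype.linearCombination ℤ y v) := by
  obtain ⟨B, hB⟩ := LinearMap.BilinMap.toQuadraticMap_surjective
    (q.comp (Fintype.linearCombination ℤ y))
  exact ⟨B, fun v => DFunLike.congr_fun hB v⟩

/-- Functoriality of `J ⊗ q` under a change of the lattice. -/
theorem tensorQuad_transform {m n : ℕ} {J : Matrix (Fin m) (Fin m) ℤ} (hJ : J.IsSymm)
    (P : Matrix (Fin n) (Fin m) ℤ) (y : Fin n → D) :
    tensorQuad q J (fun a => ∑ b, P b a • y b) = tensorQuad q (P * J * Pᵀ) y := by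
  obtain ⟨B, hB⟩ := exists_bilin q y
  have hJ' : (P * J * Pᵀ).IsSymm := by
    rw [Matrix.IsSymm, Matrix.transpose_mul, Matrix.transpose_mul, Matrix.transpose_transpose,
      hJ.eq, Matrix.mul_assoc]
  rw [tensorQuad_eq_sum q hJ' y B hB,
    tensorQuad_eq_sum q hJ _ (B.compl₁₂ P.mulVecLin P.mulVecLin)]
  · have hs : ∀ a, P.mulVecLin (Pi.single a 1) = ∑ b, P b a • Pi.single b (1 : ℤ) := by
      intro a
      ext b
      simp [Finset.sum_apply, Pi.single_apply]
    simp only [LinearMap.compl₁₂_apply, hs, map_sum, map_smul, LinearMap.sum_apply,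
      LinearMap.smul_apply, Finset.smul_sum, Matrix.mul_apply, Matrix.transpose_apply,
      Finset.sum_smul, smul_smul, Finset.sum_mul]
    simp only [← Finset.sum_product']
    exact Finset.sum_nbij' (fun t => (t.2.2.2, t.2.2.1, t.2.1, t.1))
      (fun t => (t.2.2.2, t.2.2.1, t.2.1, t.1)) (by simp) (by simp) (by simp) (by simp)
      fun t _ => by congr 1; ring
  · intro v
    rw [LinearMap.compl₁₂_apply, hB]
    congr 1
    simp only [Fintype.linearCombination_apply, Matrix.mulVecLin_apply, Matrix.mulVec, dotProduct,
      Finset.sum_smul, Finset.smul_sum, smul_smul]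
    rw [Finset.sum_comm]
    refine Finset.sum_congr rfl fun i _ => Finset.sum_congr rfl fun j _ => ?_
    rw [mul_comm]

theorem tensorQuad_add {m : ℕ} {J : Matrix (Fin m) (Fin m) ℤ} (hJ : J.IsSymm) (y l : Fin m → D) :
    tensorQuad q J (y + l) = tensorQuad q J y + tensorQuad q J l
      + ∑ b, QuadraticMap.polar q (∑ a, J a b • y a) (l b) := by
  have h1 : ∑ b, QuadraticMap.polar q (∑ a, J a b • y a) (l b)
      = ∑ a, ∑ b, J a b • QuadraticMap.polar q (y a) (l b) := by
    rw [Finset.sum_comm]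
    refine Finset.sum_congr rfl fun b _ => ?_
    change q.polarBilin (∑ a, J a b • y a) (l b) = _
    simp [map_sum, LinearMap.sum_apply]
  have h2 : ∀ x y : D, q (x + y) = q x + q y + QuadraticMap.polar q x y := by
    intro x y
    rw [QuadraticMap.polar]
    abel
  rw [h1, sum_sum_eq_diag_add_Ioi]
  simp only [tensorQuad, Pi.add_apply, h2, smul_add, Finset.sum_add_distrib,
    QuadraticMap.polar_add_left, QuadraticMap.polar_add_right]
  have h3 : ∑ i, ∑ j ∈ Finset.Ioi i, J j i • QuadraticMap.polar q (y j) (l i)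
      = ∑ i, ∑ j ∈ Finset.Ioi i, J i j • QuadraticMap.polar q (l i) (y j) := by
    refine Finset.sum_congr rfl fun i _ => Finset.sum_congr rfl fun j _ => ?_
    rw [hJ.apply i j, QuadraticMap.polar_comm]
  rw [h3]
  abel

variable {q} {Lag : AddSubgroup D} (hLag : IsLagrangian q Lag)

include hLag in
theorem polar_eq_zero {x y : D} (hx : x ∈ Lag) (hy : y ∈ Lag) : QuadraticMap.polar q x y = 0 := by
  rw [QuadraticMap.polar, hLag.isotropic _ hx, hLag.isotropic _ hy,
    hLag.isotropic _ (add_mem hx hy), sub_zero, sub_zero]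

include hLag in
theorem tensorQuad_eq_zero {m : ℕ} (J : Matrix (Fin m) (Fin m) ℤ) {y : Fin m → D}
    (hy : ∀ a, y a ∈ Lag) : tensorQuad q J y = 0 := by
  simp [tensorQuad, hLag.isotropic _ (hy _), polar_eq_zero hLag (hy _) (hy _)]

include hLag in
/-- On the orthogonal complement of `𝔏^m`, the form `J ⊗ q` is invariant under `𝔏^m`. -/
theorem tensorQuad_congr {m : ℕ} {J : Matrix (Fin m) (Fin m) ℤ} (hJ : J.IsSymm) {y y' : Fin m → D}
    (hy : ∀ a, y' a - y a ∈ Lag) (hJy : ∀ b, ∑ a, J a b • y a ∈ Lag) :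
    tensorQuad q J y' = tensorQuad q J y := by
  have h : y' = y + (y' - y) := by abel
  rw [h, tensorQuad_add q hJ, tensorQuad_eq_zero hLag J (y := y' - y) hy, add_zero,
    Finset.sum_eq_zero, add_zero]
  intro b _
  exact polar_eq_zero hLag (hJy b) (hy b)

end TensorQuad

/-! ### Comparison of two surgery presentations -/

theorem exists_splitting {A : Type*} [AddCommGroup A] [Module.Finite ℤ A] :
    ∃ s : (A ⧸ Submodule.torsion ℤ A) →ₗ[ℤ] A,
      (Submodule.torsion ℤ A).mkQ ∘ₗ s = LinearMap.id :=
  Module.projective_lifting_property _ _ (Submodule.mkQ_surjective _)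

theorem exists_mul_eq {m n : ℕ} {J : Matrix (Fin m) (Fin m) ℤ} (P : Matrix (Fin m) (Fin n) ℤ)
    (h : ∀ x, P *ᵥ x ∈ LinearMap.range J.mulVecLin) : ∃ S : Matrix (Fin m) (Fin n) ℤ, J * S = P := by
  choose v hv using fun a : Fin n => h (Pi.single a 1)
  refine ⟨Matrix.of fun i a => v a i, ?_⟩
  ext i a
  have := congrFun (hv a) i
  simpa [Matrix.mulVec, dotProduct, Matrix.mul_apply, Pi.single_apply] using this

theorem col_eq_mulVec_single {m n : ℕ} (P : Matrix (Fin m) (Fin n) ℤ) (a : Fin n) :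
    (fun b => P b a) = P *ᵥ Pi.single a 1 := by
  ext b
  simp

/-- An idempotent of the lattice onto the saturated sublattice of the vectors which become torsion
in `A`. -/
theorem exists_projection {A : Type*} [AddCommGroup A] [Module.Finite ℤ A] {m : ℕ}
    {p : (Fin m → ℤ) →ₗ[ℤ] A} (hp : Function.Surjective p) : ∃ π : Matrix (Fin m) (Fin m) ℤ,
      (∀ x, p (π *ᵥ x) ∈ Submodule.torsion ℤ A) ∧
        ∀ x, p x ∈ Submodule.torsion ℤ A → π *ᵥ x = x := by
  set h := (Submodule.torsion ℤ A).mkQ ∘ₗ p with hh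
  have hs : Function.Surjective h := (Submodule.mkQ_surjective _).comp hp
  obtain ⟨s, hs⟩ := Module.projective_lifting_property h LinearMap.id hs
  refine ⟨LinearMap.toMatrix' (LinearMap.id - s ∘ₗ h), fun x => ?_, fun x hx => ?_⟩
  · rw [LinearMap.toMatrix'_mulVec, ← Submodule.Quotient.mk_eq_zero]
    change h (x - s (h x)) = 0
    rw [map_sub]
    exact sub_eq_zero.2 (DFunLike.congr_fun hs (h x)).symm
  · rw [LinearMap.toMatrix'_mulVec]
    have : h x = 0 := (Submodule.Quotient.mk_eq_zero _).2 hx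
    simp [this]

theorem mem_torsion_int {A : Type*} [AddCommGroup A] {x : A} :
    x ∈ Submodule.torsion ℤ A ↔ ∃ n : ℤ, n ≠ 0 ∧ n • x = 0 := by
  rw [Submodule.mem_torsion_iff]
  constructor
  · rintro ⟨⟨n, hn⟩, h⟩
    exact ⟨n, nonZeroDivisors.ne_zero hn, h⟩
  · rintro ⟨n, hn, h⟩
    exact ⟨⟨n, mem_nonZeroDivisors_of_ne_zero hn⟩, h⟩

namespace SurgeryPresentation

variable {X : LinkingPair} {k l : ℕ} {f : Fin k → X} {f' : Fin l → X}

theorem proj_mulVec_J (S : SurgeryPresentation X f) (x : Fin S.m → ℤ) : S.proj (S.J *ᵥ x) = 0 := by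
  have : S.J *ᵥ x ∈ LinearMap.ker S.proj := by
    rw [S.ker_proj]
    exact ⟨x, rfl⟩
  exact this

theorem exists_mulVec_eq (S : SurgeryPresentation X f) {z : Fin S.m → ℤ} (hz : S.proj z ∈ X.Tor) :
    ∃ n : ℤ, n ≠ 0 ∧ ∃ u, S.J *ᵥ u = n • z := by
  obtain ⟨n, hn, h⟩ := mem_torsion_int.1 hz
  rw [← map_zsmul, ← LinearMap.mem_ker, S.ker_proj] at h
  exact ⟨n, hn, h⟩

theorem exists_torsion_projection (S : SurgeryPresentation X f) :
    ∃ π : Matrix (Fin S.m) (Fin S.m) ℤ,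
      (∀ x, S.proj (π *ᵥ x) ∈ X.Tor) ∧ π * S.J = S.J ∧ S.J * πᵀ = S.J := by
  obtain ⟨π, hπ, hπ'⟩ := exists_projection S.proj_surjective
  have hπJ : π * S.J = S.J := by
    refine Matrix.ext_of_mulVec_single fun i => ?_
    rw [← Matrix.mulVec_mulVec]
    refine hπ' _ ?_
    rw [proj_mulVec_J]
    exact zero_mem _
  refine ⟨π, hπ, hπJ, ?_⟩
  have := congrArg Matrix.transpose hπJ
  rwa [Matrix.transpose_mul, S.J_symm.eq] at this

/-- If `T` lifts the identity of `A` and `J₂ R = T J₁`, then the transpose of `R` lifts the identity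
of `Tor A`, since the two presentations induce the same nondegenerate form. -/
theorem proj_transpose_mulVec (S₁ : SurgeryPresentation X f) (S₂ : SurgeryPresentation X f')
    {T : Matrix (Fin S₂.m) (Fin S₁.m) ℤ} (hT : ∀ x, S₂.proj (T *ᵥ x) = S₁.proj x)
    {R : Matrix (Fin S₂.m) (Fin S₁.m) ℤ} (hR : S₁.J * Tᵀ = Rᵀ * S₂.J)
    {z : Fin S₂.m → ℤ} (hz : S₂.proj z ∈ X.Tor) : S₁.proj (Rᵀ *ᵥ z) = S₂.proj z := by
  obtain ⟨n, hn, u, hu⟩ := S₂.exists_mulVec_eq hz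
  have h1 : S₁.J *ᵥ (Tᵀ *ᵥ u) = n • (Rᵀ *ᵥ z) := by
    rw [Matrix.mulVec_mulVec, hR, ← Matrix.mulVec_mulVec, hu, Matrix.mulVec_smul]
  have h2 : S₁.proj (Rᵀ *ᵥ z) ∈ X.Tor := by
    refine mem_torsion_int.2 ⟨n, hn, ?_⟩
    rw [← map_zsmul, ← h1, proj_mulVec_J]
  have h3 : (⟨_, h2⟩ - ⟨_, hz⟩ : X.Tor) = 0 := by
    refine X.nondegenerate _ fun y => ?_
    obtain ⟨y, hy⟩ := y
    obtain ⟨x, rfl⟩ := S₁.proj_surjective y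
    have hy' : S₂.proj (T *ᵥ x) ∈ X.Tor := by rwa [hT]
    have h4 := S₁.linking _ _ _ h2 hy n hn h1
    have h5 := S₂.linking _ _ _ hz hy' n hn hu
    have h6 : (⟨S₂.proj (T *ᵥ x), hy'⟩ : X.Tor) = ⟨S₁.proj x, hy⟩ := Subtype.ext (hT x)
    rw [h6] at h5
    rw [map_sub, LinearMap.sub_apply, h4, h5, Matrix.dotProduct_mulVec, Matrix.mulVec_transpose,
      sub_self]
  exact congrArg Subtype.val (sub_eq_zero.1 h3)

/-- If `T` lifts the identity of `A`, then `J₂` and `T J₁ Tᵀ` differ by `J₂ G J₂` for a symmetric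
integer matrix `G`. -/
theorem exists_conj (S₁ : SurgeryPresentation X f) (S₂ : SurgeryPresentation X f')
    {T : Matrix (Fin S₂.m) (Fin S₁.m) ℤ} (hT : ∀ x, S₂.proj (T *ᵥ x) = S₁.proj x) :
    ∃ G : Matrix (Fin S₂.m) (Fin S₂.m) ℤ, G.IsSymm ∧
      S₂.J - T * S₁.J * Tᵀ = S₂.J * G * S₂.J := by
  obtain ⟨R, hR⟩ := exists_mul_eq (J := S₂.J) (T * S₁.J) fun x => by
    rw [← S₂.ker_proj, LinearMap.mem_ker, ← Matrix.mulVec_mulVec, hT, proj_mulVec_J]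
  have hR' : S₁.J * Tᵀ = Rᵀ * S₂.J := by
    have := congrArg Matrix.transpose hR
    rw [Matrix.transpose_mul, Matrix.transpose_mul, S₁.J_symm.eq, S₂.J_symm.eq] at this
    exact this.symm
  obtain ⟨π, hπ, hπJ, hJπ⟩ := S₂.exists_torsion_projection
  obtain ⟨V, hV⟩ := exists_mul_eq (J := S₂.J) ((1 - T * Rᵀ) * π) fun x => by
    rw [← S₂.ker_proj, LinearMap.mem_ker, ← Matrix.mulVec_mulVec, Matrix.sub_mulVec,
      Matrix.one_mulVec, map_sub, ← Matrix.mulVec_mulVec, hT,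
      proj_transpose_mulVec S₁ S₂ hT hR' (hπ x), sub_self]
  have hW : S₂.J - T * S₁.J * Tᵀ = S₂.J * V * S₂.J := by
    rw [hV, Matrix.mul_assoc, Matrix.mul_assoc, hπJ, hR', Matrix.sub_mul, Matrix.one_mul,
      Matrix.mul_assoc]
  have hU : S₂.J * (V - Vᵀ) * S₂.J = 0 := by
    have h1 : (S₂.J * V * S₂.J)ᵀ = S₂.J * V * S₂.J := by
      rw [← hW, Matrix.transpose_sub, Matrix.transpose_mul, Matrix.transpose_mul,
        Matrix.transpose_transpose, S₁.J_symm.eq, S₂.J_symm.eq, Matrix.mul_assoc]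
    rw [Matrix.transpose_mul, Matrix.transpose_mul, S₂.J_symm.eq, ← Matrix.mul_assoc] at h1
    rw [Matrix.mul_sub, Matrix.sub_mul, h1, sub_self]
  have hsymm : πᵀ * (V - Vᵀ) * π = 0 := by
    ext i j
    obtain ⟨a, ha, u, hu⟩ := S₂.exists_mulVec_eq (hπ (Pi.single i 1))
    obtain ⟨b, hb, v, hv⟩ := S₂.exists_mulVec_eq (hπ (Pi.single j 1))
    have h1 : (πᵀ * (V - Vᵀ) * π) i j
        = (π *ᵥ Pi.single i 1) ⬝ᵥ (V - Vᵀ) *ᵥ (π *ᵥ Pi.single j 1) := by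
      rw [← Matrix.vecMul_transpose, ← Matrix.dotProduct_mulVec, Matrix.mulVec_mulVec,
        Matrix.mulVec_mulVec]
      simp
    have h2 : a * b * (πᵀ * (V - Vᵀ) * π) i j = 0 := by
      have h3 : a * b * (πᵀ * (V - Vᵀ) * π) i j = (S₂.J *ᵥ u) ⬝ᵥ (V - Vᵀ) *ᵥ (S₂.J *ᵥ v) := by
        rw [h1, hu, hv, Matrix.mulVec_smul, smul_dotProduct, dotProduct_smul, smul_eq_mul,
          smul_eq_mul, mul_assoc]
      rw [h3, Matrix.mulVec_mulVec, ← Matrix.vecMul_transpose, S₂.J_symm.eq,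
        ← Matrix.dotProduct_mulVec, Matrix.mulVec_mulVec, ← Matrix.mul_assoc, hU,
        Matrix.zero_mulVec, dotProduct_zero]
    simpa [ha, hb] using h2
  refine ⟨πᵀ * V * π, ?_, ?_⟩
  · rw [Matrix.mul_sub, Matrix.sub_mul, sub_eq_zero] at hsymm
    rw [Matrix.IsSymm, Matrix.transpose_mul, Matrix.transpose_mul, Matrix.transpose_transpose,
      ← Matrix.mul_assoc]
    exact hsymm.symm
  · rw [hW]
    simp only [← Matrix.mul_assoc]
    rw [hJπ]
    simp only [Matrix.mul_assoc]
    rw [hπJ]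

end SurgeryPresentation

/-! ### Evaluation of the surgery formula by means of the Lagrangian subgroup -/

section Pairing

variable {D : Type*} [AddCommGroup D] (q : QuadraticMap ℤ D QZ) (Lag : AddSubgroup D)

/-- The map `D → 𝔏^*` induced by `b_q`. -/
def pairing : D →ₗ[ℤ] (Lag →ₗ[ℤ] QZ) :=
  q.polarBilin.compl₁₂ LinearMap.id Lag.subtype.toIntLinearMap

@[simp] theorem pairing_apply (x : D) (c : Lag) :
    pairing q Lag x c = QuadraticMap.polar q x c := rfl

variable {q Lag}

theorem pairing_eq_zero_iff (hLag : IsLagrangian q Lag) {x : D} :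
    pairing q Lag x = 0 ↔ x ∈ Lag := by
  constructor
  · intro h
    exact hLag.coisotropic x fun y hy => DFunLike.congr_fun h (⟨y, hy⟩ : Lag)
  · intro h
    ext c
    exact polar_eq_zero hLag h c.2

/-- `D/𝔏` embeds into `𝔏^*`, and `𝔏` embeds into the dual of its image by nondegeneracy, so the
orders agree. -/
theorem pairing_surjective_and_card [Finite D] (hq : IsNondegenerate q)
    (hLag : IsLagrangian q Lag) :
    Function.Surjective (pairing q Lag) ∧ Nat.card D = Nat.card Lag ^ 2 := by
  set R := LinearMap.range (pairing q Lag) with hR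
  have hker : Nat.card (LinearMap.ker (pairing q Lag)) = Nat.card Lag :=
    Nat.card_congr (Equiv.subtypeEquivRight fun x => pairing_eq_zero_iff hLag)
  have hRL : Nat.card R ≤ Nat.card Lag :=
    (Nat.card_le_card_of_injective _ R.injective_subtype).trans card_dual_le
  have hLR : Nat.card Lag ≤ Nat.card R := by
    have hinj : Function.Injective (R.subtype.flip) := by
      rw [← LinearMap.ker_eq_bot, LinearMap.ker_eq_bot']
      intro c hc
      refine Subtype.ext (hq _ fun y => ?_)
      rw [QuadraticMap.polar_comm]
      exact DFunLike.congr_fun hc ⟨pairing q Lag y, ⟨y, rfl⟩⟩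
    exact (Nat.card_le_card_of_injective _ hinj).trans card_dual_le
  have hcard : Nat.card R = Nat.card Lag := le_antisymm hRL hLR
  constructor
  · rw [← LinearMap.range_eq_top, ← hR]
    have h : Function.Bijective R.subtype := by
      refine (Nat.bijective_iff_injective_and_card _).2 ⟨R.injective_subtype, ?_⟩
      rw [hcard, card_dual]
    exact (Submodule.eq_top_iff'.2 fun x => by
      obtain ⟨y, rfl⟩ := h.2 x
      exact y.2)
  · rw [Submodule.card_eq_card_quotient_mul_card (LinearMap.ker (pairing q Lag)), hker,
      Nat.card_congr (pairing q Lag).quotKerEquivRange.toEquiv, ← hR, hcard, sq]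

end Pairing

section Section

variable {D : Type*} [AddCommGroup D] (q : QuadraticMap ℤ D QZ) (Lag : AddSubgroup D)

open Classical in
/-- A set-theoretic section of `D → 𝔏^*`. -/
def pairingLift (χ : Lag →ₗ[ℤ] QZ) : D := Function.invFun (pairing q Lag) χ

theorem pairing_pairingLift (h : Function.Surjective (pairing q Lag)) (χ : Lag →ₗ[ℤ] QZ) :
    pairing q Lag (pairingLift q Lag χ) = χ := Function.rightInverse_invFun h χ

end Section

namespace SurgeryPresentation

variable {D : Type*} [AddCommGroup D] (q : QuadraticMap ℤ D QZ) (Lag : AddSubgroup D)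
variable {X : LinkingPair} {k l : ℕ} {f : Fin k → X} {f' : Fin l → X}

/-- The phase attached to `β ∈ Hom(A, 𝔏^*)` by a surgery presentation: the value of `J ⊗ q` on a
lift of `β ∘ p : ℤ^m → 𝔏^* = D/𝔏` to `D`. -/
def phase (S : SurgeryPresentation X f) (β : X →ₗ[ℤ] (Lag →ₗ[ℤ] QZ)) : QZ :=
  tensorQuad q S.J fun a => pairingLift q Lag (β (S.proj (Pi.single a 1)))

theorem pairing_sum (hs : Function.Surjective (pairing q Lag)) (S : SurgeryPresentation X f)
    (β : X →ₗ[ℤ] (Lag →ₗ[ℤ] QZ)) (v : Fin S.m → ℤ) :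
    pairing q Lag (∑ b, v b • pairingLift q Lag (β (S.proj (Pi.single b 1)))) = β (S.proj v) := by
  have hv : v = ∑ b, v b • Pi.single b (1 : ℤ) := by
    ext i
    simp [Finset.sum_apply, Pi.single_apply]
  conv_rhs => rw [hv]
  simp only [map_sum, map_zsmul, pairing_pairingLift q Lag hs]

variable {q Lag} (hs : Function.Surjective (pairing q Lag)) (hLag : IsLagrangian q Lag)

include hs hLag in
/-- The phase does not depend on the surgery presentation. The transpose of a lift `T` of the
identity of `A` carries a lift of `β` for `S₂` to one for `S₁`, and the difference `J₂ G J₂` of the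
matrices contributes the value of `G ⊗ q` on `J₂ y`, whose entries lie in `𝔏`. -/
theorem phase_congr (S₁ : SurgeryPresentation X f) (S₂ : SurgeryPresentation X f')
    (β : X →ₗ[ℤ] (Lag →ₗ[ℤ] QZ)) : S₁.phase q Lag β = S₂.phase q Lag β := by
  obtain ⟨t, ht⟩ := Module.projective_lifting_property S₂.proj S₁.proj S₂.proj_surjective
  set T := LinearMap.toMatrix' t with hTdef
  have hT : ∀ x, S₂.proj (T *ᵥ x) = S₁.proj x := fun x => by
    rw [hTdef, LinearMap.toMatrix'_mulVec]
    exact DFunLike.congr_fun ht x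
  obtain ⟨G, hG, hGJ⟩ := S₁.exists_conj S₂ hT
  set y := fun a => pairingLift q Lag (β (S₂.proj (Pi.single a 1))) with hy
  have h1 : S₁.phase q Lag β = tensorQuad q (T * S₁.J * Tᵀ) y := by
    rw [← tensorQuad_transform q S₁.J_symm]
    refine (tensorQuad_congr hLag S₁.J_symm (fun a => ?_) (fun b => ?_)).symm
    · rw [← pairing_eq_zero_iff hLag, map_sub, hy, S₂.pairing_sum q Lag hs β fun b => T b a,
        pairing_pairingLift q Lag hs, col_eq_mulVec_single, hT, sub_self]
    · rw [← pairing_eq_zero_iff hLag, S₁.pairing_sum q Lag hs β fun a => S₁.J a b,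
        col_eq_mulVec_single, proj_mulVec_J, map_zero]
  have h2 : tensorQuad q (S₂.J * G * S₂.J) y = 0 := by
    have h3 := tensorQuad_transform q hG S₂.J y
    rw [S₂.J_symm.eq] at h3
    rw [← h3]
    refine tensorQuad_eq_zero hLag _ fun a => ?_
    rw [← pairing_eq_zero_iff hLag, hy, S₂.pairing_sum q Lag hs β fun b => S₂.J b a,
      col_eq_mulVec_single, proj_mulVec_J, map_zero]
  rw [← hGJ] at h2
  have h4 : ∀ M N : Matrix (Fin S₂.m) (Fin S₂.m) ℤ,
      tensorQuad q (M - N) y = tensorQuad q M y - tensorQuad q N y := by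
    intro M N
    simp only [tensorQuad, Matrix.sub_apply, sub_smul, Finset.sum_sub_distrib]
    abel
  rw [h4] at h2
  rw [h1]
  exact (sub_eq_zero.1 h2).symm

include hs hLag in
/-- An idempotent `π` onto the vectors which are torsion in `A` fixes `J`, so the lift of `β` may be
replaced by a lift of the restriction of `β` to `Tor A`. -/
theorem phase_congr_of_eqOn_torsion (S : SurgeryPresentation X f)
    {β β' : X →ₗ[ℤ] (Lag →ₗ[ℤ] QZ)} (h : ∀ x ∈ X.Tor, β x = β' x) :
    S.phase q Lag β = S.phase q Lag β' := by
  obtain ⟨π, hπ, hπJ, hJπ⟩ := S.exists_torsion_projection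
  have h1 : ∀ γ : X →ₗ[ℤ] (Lag →ₗ[ℤ] QZ), S.phase q Lag γ = tensorQuad q S.J
      fun a => ∑ b, π b a • pairingLift q Lag (γ (S.proj (Pi.single b 1))) := by
    intro γ
    rw [tensorQuad_transform q S.J_symm, hπJ, hJπ, phase]
  rw [h1, h1]
  refine tensorQuad_congr hLag S.J_symm (fun a => ?_) (fun b => ?_)
  · rw [← pairing_eq_zero_iff hLag, map_sub, S.pairing_sum q Lag hs β fun b => π b a,
      S.pairing_sum q Lag hs _ fun b => π b a, col_eq_mulVec_single, h _ (hπ _), sub_self]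
  · rw [← pairing_eq_zero_iff hLag, map_sum]
    simp only [map_zsmul, fun a => S.pairing_sum q Lag hs β' fun b => π b a]
    simp only [← map_zsmul, ← map_sum]
    have h2 : ∑ a, S.J a b • (fun c => π c a) = (fun c => (π * S.J) c b) := by
      ext c
      simp [Matrix.mul_apply, mul_comm]
    rw [h2, hπJ, col_eq_mulVec_single, proj_mulVec_J, map_zero]

end SurgeryPresentation

namespace SurgeryPresentation

variable {D : Type*} [AddCommGroup D] {q : QuadraticMap ℤ D QZ} {Lag : AddSubgroup D}
variable {X : LinkingPair} {k : ℕ} {f : Fin k → X}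

/-- A vector of characters of `𝔏` annihilated by `J` is the same as a homomorphism `A → 𝔏^*`. -/
theorem exists_hom_of_kernel {E : Type*} [AddCommGroup E] (S : SurgeryPresentation X f)
    {χ : Fin S.m → E} (hχ : ∀ b, ∑ a, S.J a b • χ a = 0) :
    ∃ β : X →ₗ[ℤ] E, ∀ a, β (S.proj (Pi.single a 1)) = χ a := by
  have hle : LinearMap.ker S.proj ≤ LinearMap.ker (Fintype.linearCombination ℤ χ) := by
    rw [S.ker_proj]
    rintro _ ⟨v, rfl⟩
    rw [LinearMap.mem_ker, Fintype.linearCombination_apply]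
    simp only [Matrix.mulVecLin_apply, Matrix.mulVec, dotProduct, Finset.sum_smul]
    rw [Finset.sum_comm]
    refine Finset.sum_eq_zero fun b _ => ?_
    simp only [mul_comm _ (v b), mul_smul, ← Finset.smul_sum]
    rw [hχ, smul_zero]
  refine ⟨(LinearMap.ker S.proj).liftQ _ hle ∘ₗ
    (S.proj.quotKerEquivOfSurjective S.proj_surjective).symm.toLinearMap, fun a => ?_⟩
  have h : (S.proj.quotKerEquivOfSurjective S.proj_surjective).symm (S.proj (Pi.single a 1))
      = Submodule.Quotient.mk (Pi.single a 1) := by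
    rw [LinearEquiv.symm_apply_eq]
    rfl
  rw [LinearMap.comp_apply, LinearEquiv.coe_coe, h, Submodule.liftQ_apply,
    Fintype.linearCombination_apply_single, one_smul]

theorem hom_ext {E : Type*} [AddCommGroup E] (S : SurgeryPresentation X f) {β γ : X →ₗ[ℤ] E}
    (h : ∀ a, β (S.proj (Pi.single a 1)) = γ (S.proj (Pi.single a 1))) : β = γ := by
  have h1 : β ∘ₗ S.proj = γ ∘ₗ S.proj := (Pi.basisFun ℤ (Fin S.m)).ext fun a => by simpa using h a
  ext x
  obtain ⟨v, rfl⟩ := S.proj_surjective x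
  exact DFunLike.congr_fun h1 v

/-- The surgery formula as a finite Fourier series: summing over the cosets of `𝔏^m` first leaves
only the vectors of `D^m` whose image in `(D/𝔏)^m = (𝔏^*)^m` is annihilated by `J`, that is, the
homomorphisms `A → 𝔏^*`. -/
theorem value_eq [Finite D] (hq : IsNondegenerate q) (hLag : IsLagrangian q Lag)
    [Fintype (X →ₗ[ℤ] (Lag →ₗ[ℤ] QZ))] (S : SurgeryPresentation X f) (c : Fin k → Lag) :
    S.value q (fun i => (c i : D)) = (Nat.card Lag : ℂ)⁻¹ *
      ∑ β : X →ₗ[ℤ] (Lag →ₗ[ℤ] QZ), e (-S.phase q Lag β) * e (-∑ i, β (f i) (c i)) := by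
  classical
  obtain ⟨hs, hcard⟩ := pairing_surjective_and_card hq hLag
  cases nonempty_fintype D
  have : Fintype Lag := Fintype.ofFinite _
  have : Fintype (Lag →ₗ[ℤ] QZ) := Fintype.ofFinite _
  set σ := pairingLift q Lag with hσ
  have hσ' : ∀ χ c, QuadraticMap.polar q (σ χ) (c : Lag) = χ c := fun χ c =>
    DFunLike.congr_fun (pairing_pairingLift q Lag hs χ) c
  have hbij : Function.Bijective (fun t : (Fin S.m → (Lag →ₗ[ℤ] QZ)) × (Fin S.m → Lag) =>
      fun a => σ (t.1 a) + (t.2 a : D)) := by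
    have hpair : ∀ χ (c : Lag), pairing q Lag (σ χ + c) = χ := fun χ c => by
      rw [map_add, pairing_pairingLift q Lag hs, (pairing_eq_zero_iff hLag).2 c.2, add_zero]
    constructor
    · rintro ⟨χ, l⟩ ⟨χ', l'⟩ h
      have h1 : χ = χ' := funext fun a => by
        have := congrArg (pairing q Lag) (congrFun h a)
        rwa [hpair, hpair] at this
      subst h1
      refine Prod.ext rfl (funext fun a => Subtype.ext ?_)
      exact add_left_cancel (congrFun h a)
    · intro x
      have hx : ∀ a, x a - σ (pairing q Lag (x a)) ∈ Lag := fun a => by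
        rw [← pairing_eq_zero_iff hLag, map_sub, pairing_pairingLift q Lag hs, sub_self]
      exact ⟨(fun a => pairing q Lag (x a), fun a => ⟨_, hx a⟩), funext fun a => by simp⟩
  -- The phases on a coset of `𝔏^m`.
  set G : (Fin S.m → (Lag →ₗ[ℤ] QZ)) → ℂ := fun χ =>
    e (-(tensorQuad q S.J (fun a => σ (χ a)) + ∑ a, ∑ i, S.F a i • χ a (c i))) with hG
  set h : (Fin S.m → (Lag →ₗ[ℤ] QZ)) → (Fin S.m → Lag) →ₗ[ℤ] QZ := fun χ =>
    -∑ b, (∑ a, S.J a b • χ a) ∘ₗ LinearMap.proj b with hh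
  have hterm : ∀ (χ : Fin S.m → (Lag →ₗ[ℤ] QZ)) (l : Fin S.m → Lag),
      e (-(tensorQuad q S.J (fun a => σ (χ a) + (l a : D))
        + ∑ a, ∑ i, S.F a i • QuadraticMap.polar q (σ (χ a) + (l a : D)) (c i)
        + tensorQuad q S.J' fun i => (c i : D))) = G χ * e (h χ l) := by
    intro χ l
    have h1 := tensorQuad_add q S.J_symm (fun a => σ (χ a)) (fun a => (l a : D))
    rw [tensorQuad_eq_zero hLag S.J fun a => (l a).2, add_zero] at h1
    have h2 : (fun a => σ (χ a) + (l a : D)) = (fun a => σ (χ a)) + fun a => (l a : D) := rfl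
    have h3 : ∀ b, QuadraticMap.polar q (∑ a, S.J a b • σ (χ a)) (l b)
        = (∑ a, S.J a b • χ a) (l b) := fun b => by
      change pairing q Lag (∑ a, S.J a b • σ (χ a)) (l b) = _
      rw [map_sum]
      simp only [map_zsmul, hσ, pairing_pairingLift q Lag hs]
    have h4 : h χ l = -∑ b, (∑ a, S.J a b • χ a) (l b) := by
      rw [hh]
      simp only [LinearMap.neg_apply, LinearMap.sum_apply, LinearMap.comp_apply,
        LinearMap.proj_apply]
    rw [h2, h1, tensorQuad_eq_zero hLag S.J' fun i => (c i).2, add_zero, hG, ← e_add, h4]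
    congr 1
    simp only [QuadraticMap.polar_add_left, polar_eq_zero hLag (l _).2 (c _).2, add_zero, hσ', h3]
    abel
  have hsum : ∀ χ, ∑ l, e (h χ l)
      = if ∀ b, ∑ a, S.J a b • χ a = 0 then (Nat.card Lag : ℂ) ^ S.m else 0 := by
    intro χ
    split_ifs with hχ
    · have : h χ = 0 := by
        rw [hh]
        simp only [hχ, LinearMap.zero_comp, Finset.sum_const_zero, neg_zero]
      simp [this]
    · refine sum_e_eq_zero fun h0 => hχ fun b => ?_
      ext x
      have h5 := DFunLike.congr_fun h0 (Pi.single b x)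
      simp only [hh, LinearMap.neg_apply, LinearMap.sum_apply, LinearMap.comp_apply,
        LinearMap.proj_apply, LinearMap.zero_apply, neg_eq_zero] at h5
      rw [Finset.sum_eq_single b] at h5
      · simpa using h5
      · intro b' _ hb'
        simp [Pi.single_eq_of_ne hb']
      · simp
  have hmain : ∑ x : Fin S.m → D, e (-(tensorQuad q S.J x
        + ∑ a, ∑ i, S.F a i • QuadraticMap.polar q (x a) (c i)
        + tensorQuad q S.J' fun i => (c i : D)))
      = (Nat.card Lag : ℂ) ^ S.m * ∑ β : X →ₗ[ℤ] (Lag →ₗ[ℤ] QZ),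
        e (-S.phase q Lag β) * e (-∑ i, β (f i) (c i)) := by
    rw [← hbij.sum_comp, Fintype.sum_prod_type]
    simp only [hterm, ← Finset.mul_sum, hsum, mul_ite, mul_zero]
    rw [← Finset.sum_filter, Finset.mul_sum]
    symm
    refine Finset.sum_bij (fun β _ a => β (S.proj (Pi.single a 1))) ?_ ?_ ?_ ?_
    · intro β _
      simp only [Finset.mem_filter, Finset.mem_univ, true_and]
      intro b
      have h6 : S.proj (S.J *ᵥ Pi.single b 1) = 0 := proj_mulVec_J S _
      have h7 : S.J *ᵥ Pi.single b 1 = ∑ a, S.J a b • Pi.single a (1 : ℤ) := by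
        ext i
        simp [Finset.sum_apply, Pi.single_apply]
      rw [h7, map_sum] at h6
      simp only [map_zsmul] at h6
      rw [← map_zero β, ← h6, map_sum]
      simp only [map_zsmul]
    · intro β _ γ _ hβγ
      exact S.hom_ext fun a => congrFun hβγ a
    · intro χ hχ
      simp only [Finset.mem_filter, Finset.mem_univ, true_and] at hχ
      obtain ⟨β, hβ⟩ := S.exists_hom_of_kernel hχ
      exact ⟨β, Finset.mem_univ _, funext hβ⟩
    · intro β _
      rw [mul_comm, hG, ← e_add]
      congr 2
      rw [neg_add, phase]
      congr 2
      rw [Finset.sum_comm]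
      refine Finset.sum_congr rfl fun i _ => ?_
      have h8 : (fun a => S.F a i) = ∑ a, S.F a i • Pi.single a (1 : ℤ) := by
        ext j
        simp [Finset.sum_apply, Pi.single_apply]
      rw [← S.proj_F i, h8, map_sum, map_sum, LinearMap.sum_apply]
      simp only [map_zsmul, LinearMap.smul_apply]
  rw [value, finsum_eq_sum_of_fintype, hmain, ← mul_assoc]
  congr 1
  have hpos : (0 : ℝ) < Nat.card Lag := by exact_mod_cast Nat.card_pos
  have hr : ((Nat.card D : ℝ) ^ (-((S.m : ℝ) + 1) / 2)) * (Nat.card Lag : ℝ) ^ S.m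
      = (Nat.card Lag : ℝ)⁻¹ := by
    rw [hcard, Nat.cast_pow, ← Real.rpow_natCast (Nat.card Lag : ℝ) 2, ← Real.rpow_mul hpos.le,
      ← Real.rpow_natCast (Nat.card Lag : ℝ) S.m, ← Real.rpow_add hpos, ← Real.rpow_neg_one]
    congr 1
    push_cast
    ring
  rw [← Complex.ofReal_natCast (Nat.card Lag), ← Complex.ofReal_pow, ← Complex.ofReal_mul, hr,
    Complex.ofReal_inv]

end SurgeryPresentation

/-! ### Fourier expansion of the partition function -/

/-- Whether `(A, ℓ, f)` has a surgery presentation does not depend on `f`: the blocks `F` and `J'`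
can be replaced. -/
theorem SurgeryPresentation.nonempty_of_nonempty {X : LinkingPair} {k l : ℕ} {f : Fin k → X}
    (f' : Fin l → X) (h : Nonempty (SurgeryPresentation X f)) :
    Nonempty (SurgeryPresentation X f') := by
  obtain ⟨S⟩ := h
  choose F hF using fun i => S.proj_surjective (f' i)
  exact ⟨⟨S.m, S.J, Matrix.of fun a i => F i a, 0, S.J_symm, Matrix.transpose_zero, S.proj,
    S.proj_surjective, S.ker_proj, S.linking, hF⟩⟩

theorem lift_flip_sum {X : LinkingPair} {k : ℕ} {E : Type*} [AddCommGroup E]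
    (β : X →ₗ[ℤ] (E →ₗ[ℤ] QZ)) (f : Fin k → X) (c : Fin k → E) :
    TensorProduct.lift β.flip (∑ i, c i ⊗ₜ[ℤ] f i) = ∑ i, β (f i) (c i) := by
  simp [map_sum]

section Amplitude

variable {D : Type*} [AddCommGroup D] (q : QuadraticMap ℤ D QZ) (Lag : AddSubgroup D)
  (X : LinkingPair)

open Classical in
/-- The amplitude of `β ∈ Hom(A, 𝔏^*)` in the Fourier expansion of the partition function of
`(A, ℓ)`: a number of absolute value one if `(A, ℓ)` has a surgery presentation, and zero
otherwise. -/
def amplitude (β : X →ₗ[ℤ] (Lag →ₗ[ℤ] QZ)) : ℂ :=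
  if h : Nonempty (SurgeryPresentation X (Fin.elim0 : Fin 0 → X)) then
    e (-h.some.phase q Lag β) else 0

theorem norm_amplitude_le (β : X →ₗ[ℤ] (Lag →ₗ[ℤ] QZ)) : ‖amplitude q Lag X β‖ ≤ 1 := by
  rw [amplitude]
  split_ifs <;> simp

variable {q Lag X} [Finite D] (hq : IsNondegenerate q) (hLag : IsLagrangian q Lag)

include hq hLag in
theorem amplitude_congr {β β' : X →ₗ[ℤ] (Lag →ₗ[ℤ] QZ)} (h : ∀ x ∈ X.Tor, β x = β' x) :
    amplitude q Lag X β = amplitude q Lag X β' := by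
  rw [amplitude, amplitude]
  split_ifs with hS
  · rw [hS.some.phase_congr_of_eqOn_torsion (pairing_surjective_and_card hq hLag).1 hLag h]
  · rfl

variable [Fintype (X →ₗ[ℤ] (Lag →ₗ[ℤ] QZ))] {k : ℕ} {f : Fin k → X}

include hq hLag in
theorem SurgeryPresentation.value_eq_sum_amplitude (S : SurgeryPresentation X f)
    (c : Fin k → Lag) : S.value q (fun i => (c i : D)) = (Nat.card Lag : ℂ)⁻¹ *
      ∑ β : X →ₗ[ℤ] (Lag →ₗ[ℤ] QZ), amplitude q Lag X β * e (-∑ i, β (f i) (c i)) := by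
  rw [S.value_eq hq hLag]
  congr 1
  refine Finset.sum_congr rfl fun β _ => ?_
  have h : Nonempty (SurgeryPresentation X (Fin.elim0 : Fin 0 → X)) :=
    nonempty_of_nonempty _ ⟨S⟩
  rw [amplitude, dif_pos h,
    S.phase_congr (pairing_surjective_and_card hq hLag).1 hLag h.some β]

include hq hLag in
theorem partitionFunction_eq_sum (f : Fin k → X) (c : Fin k → Lag) :
    partitionFunction q Lag X f c = (Nat.card Lag : ℂ)⁻¹ *
      ∑ β : X →ₗ[ℤ] (Lag →ₗ[ℤ] QZ), amplitude q Lag X β * e (-∑ i, β (f i) (c i)) := by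
  rw [partitionFunction]
  split_ifs with h
  · exact h.some.value_eq_sum_amplitude hq hLag c
  · have h' : ¬ Nonempty (SurgeryPresentation X (Fin.elim0 : Fin 0 → X)) :=
      fun h1 => h (SurgeryPresentation.nonempty_of_nonempty f h1)
    simp [amplitude, h']

include hq hLag in
theorem thetaPartitionFunction_eq_sum (θ : Lag ⊗[ℤ] X) :
    thetaPartitionFunction q Lag X θ = (Nat.card Lag : ℂ)⁻¹ *
      ∑ β : X →ₗ[ℤ] (Lag →ₗ[ℤ] QZ),
        amplitude q Lag X β * e (-TensorProduct.lift β.flip θ) := by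
  rw [thetaPartitionFunction, partitionFunction_eq_sum hq hLag]
  simp only [← lift_flip_sum]
  rw [(exists_tensor_eq_sum Lag X θ).choose_spec]

include hq hLag in
theorem partitionFunction_eq_theta (f : Fin k → X) (c : Fin k → Lag) :
    partitionFunction q Lag X f c = thetaPartitionFunction q Lag X (∑ i, c i ⊗ₜ[ℤ] f i) := by
  rw [thetaPartitionFunction_eq_sum hq hLag, partitionFunction_eq_sum hq hLag]
  simp only [lift_flip_sum]

include hq hLag in
theorem SurgeryPresentation.value_eq_partitionFunction (S : SurgeryPresentation X f)
    (c : Fin k → Lag) : S.value q (fun i => (c i : D)) = partitionFunction q Lag X f c := by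
  rw [S.value_eq_sum_amplitude hq hLag, partitionFunction_eq_sum hq hLag]

include hq hLag in
theorem norm_partitionFunction_le (f : Fin k → X) (c : Fin k → Lag) :
    ‖partitionFunction q Lag X f c‖
      ≤ (Nat.card Lag : ℝ)⁻¹ * Nat.card (X →ₗ[ℤ] (Lag →ₗ[ℤ] QZ)) := by
  rw [partitionFunction_eq_sum hq hLag, norm_mul, norm_inv, Complex.norm_natCast]
  refine mul_le_mul_of_nonneg_left ?_ (by positivity)
  refine (norm_sum_le _ _).trans ?_
  rw [Nat.card_eq_fintype_card, ← Finset.card_univ, ← nsmul_one]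
  refine Finset.sum_le_card_nsmul _ _ _ fun β _ => ?_
  rw [norm_mul, norm_e, mul_one]
  exact norm_amplitude_le q Lag X β

end Amplitude

/-! ### The contribution of one pair to the Dirichlet series -/

section DirichletTerm

variable {D : Type*} [AddCommGroup D] {q : QuadraticMap ℤ D QZ} {Lag : AddSubgroup D}
  {X : LinkingPair} [Finite D] (hq : IsNondegenerate q) (hLag : IsLagrangian q Lag)

/-- Restriction `Hom(A, E) → Hom(Tor A, E)`. -/
def restrictTor (A E : Type*) [AddCommGroup A] [AddCommGroup E] :
    (A →ₗ[ℤ] E) →ₗ[ℤ] (Submodule.torsion ℤ A →ₗ[ℤ] E) :=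
  LinearMap.lcomp ℤ E (Submodule.torsion ℤ A).subtype

theorem exists_retraction {A : Type*} [AddCommGroup A] [Module.Finite ℤ A] :
    ∃ r : A →ₗ[ℤ] Submodule.torsion ℤ A, ∀ x : Submodule.torsion ℤ A, r x = x := by
  obtain ⟨s, hs⟩ := exists_splitting (A := A)
  have h : ∀ x, x - s (Submodule.Quotient.mk x) ∈ Submodule.torsion ℤ A := fun x => by
    rw [← Submodule.Quotient.mk_eq_zero, Submodule.Quotient.mk_sub]
    exact sub_eq_zero.2 (DFunLike.congr_fun hs (Submodule.Quotient.mk x)).symm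
  refine ⟨(LinearMap.id - s ∘ₗ (Submodule.torsion ℤ A).mkQ).codRestrict _ h, fun x => ?_⟩
  refine Subtype.ext ?_
  have h0 : (Submodule.torsion ℤ A).mkQ (x : A) = 0 := (Submodule.Quotient.mk_eq_zero _).2 x.2
  change (x : A) - s ((Submodule.torsion ℤ A).mkQ (x : A)) = x
  rw [h0, map_zero, sub_zero]

theorem restrictTor_surjective {A E : Type*} [AddCommGroup A] [Module.Finite ℤ A]
    [AddCommGroup E] : Function.Surjective (restrictTor A E) := by
  obtain ⟨r, hr⟩ := exists_retraction (A := A)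
  intro h
  refine ⟨h ∘ₗ r, ?_⟩
  ext x
  exact congrArg h (hr x)

theorem card_hom_eq {A E : Type*} [AddCommGroup A] [Module.Finite ℤ A] [AddCommGroup E]
    [Finite E] : Nat.card (A →ₗ[ℤ] E) = Nat.card (LinearMap.ker (restrictTor A E))
      * Nat.card (Submodule.torsion ℤ A →ₗ[ℤ] E) := by
  rw [Submodule.card_eq_card_quotient_mul_card (LinearMap.ker (restrictTor A E)),
    Nat.card_congr ((restrictTor A E).quotKerEquivOfSurjective restrictTor_surjective).toEquiv]

include hq hLag in
/-- Fourier inversion for the function `θ ↦ Z(A, ℓ; θ)`, which may be restricted to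
`𝔏 ⊗ Tor A` since the amplitudes only depend on the restrictions to `Tor A`. -/
theorem sum_theta_eq [Fintype (Lag ⊗[ℤ] X.Tor)] (α : X →ₗ[ℤ] (Lag →ₗ[ℤ] QZ)) :
    ∑ θ : Lag ⊗[ℤ] X.Tor, thetaPartitionFunction q Lag X (X.Tor.subtype.lTensor Lag θ) *
        e (TensorProduct.lift α.flip (X.Tor.subtype.lTensor Lag θ))
      = (Nat.card (Lag ⊗[ℤ] X) : ℂ) * ((Nat.card Lag : ℂ)⁻¹ * amplitude q Lag X α) := by
  classical
  have := finite_linearMap (A := X) (E := Lag →ₗ[ℤ] QZ)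
  have : Fintype (X →ₗ[ℤ] (Lag →ₗ[ℤ] QZ)) := Fintype.ofFinite _
  set R := restrictTor X (Lag →ₗ[ℤ] QZ) with hR
  have hcard : Nat.card (Lag ⊗[ℤ] X) = Nat.card (LinearMap.ker R) * Nat.card (Lag ⊗[ℤ] X.Tor) := by
    rw [card_tensor, card_hom_eq]
    congr 1
    exact card_tensor.symm
  have hfib : ∀ β, (∑ θ : Lag ⊗[ℤ] X.Tor, e (TensorProduct.lift (α - β).flip
      (X.Tor.subtype.lTensor Lag θ))) =
        if α - β ∈ LinearMap.ker R then (Nat.card (Lag ⊗[ℤ] X.Tor) : ℂ) else 0 := by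
    intro β
    set h : Lag ⊗[ℤ] X.Tor →ₗ[ℤ] QZ :=
      TensorProduct.lift (α - β).flip ∘ₗ X.Tor.subtype.lTensor Lag with hh
    have hzero : h = 0 ↔ α - β ∈ LinearMap.ker R := by
      rw [LinearMap.mem_ker]
      constructor
      · intro h0
        ext x c
        exact DFunLike.congr_fun h0 (c ⊗ₜ x)
      · intro h0
        refine TensorProduct.ext' fun c x => ?_
        exact DFunLike.congr_fun (DFunLike.congr_fun h0 x) c
    split_ifs with hk
    · have h0 := hzero.2 hk
      have : ∀ θ, TensorProduct.lift (α - β).flip (X.Tor.subtype.lTensor Lag θ) = 0 := fun θ =>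
        DFunLike.congr_fun h0 θ
      simp [this]
    · exact sum_e_eq_zero (h := h) (fun h0 => hk (hzero.1 h0))
  have hexp : ∀ θ : Lag ⊗[ℤ] X.Tor,
      thetaPartitionFunction q Lag X (X.Tor.subtype.lTensor Lag θ) *
        e (TensorProduct.lift α.flip (X.Tor.subtype.lTensor Lag θ))
      = (Nat.card Lag : ℂ)⁻¹ * ∑ β, amplitude q Lag X β *
        e (TensorProduct.lift (α - β).flip (X.Tor.subtype.lTensor Lag θ)) := by
    intro θ
    rw [thetaPartitionFunction_eq_sum hq hLag, mul_assoc, Finset.sum_mul]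
    congr 1
    refine Finset.sum_congr rfl fun β _ => ?_
    rw [mul_assoc, ← e_add]
    congr 2
    have : (α - β).flip = α.flip - β.flip := rfl
    rw [this]
    generalize X.Tor.subtype.lTensor Lag θ = t
    induction t using TensorProduct.induction_on with
    | zero => simp
    | tmul c x => simp; abel
    | add x y hx hy =>
      rw [map_add, map_add, map_add, ← hx, ← hy]
      abel
  simp only [hexp]
  rw [← Finset.mul_sum, Finset.sum_comm]
  simp only [← Finset.mul_sum, hfib, mul_ite, mul_zero]
  rw [← Finset.sum_filter]
  have hamp : ∀ β ∈ Finset.univ.filter (fun β => α - β ∈ LinearMap.ker R),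
      amplitude q Lag X β * (Nat.card (Lag ⊗[ℤ] X.Tor) : ℂ)
        = amplitude q Lag X α * (Nat.card (Lag ⊗[ℤ] X.Tor) : ℂ) := by
    intro β hβ
    simp only [Finset.mem_filter, Finset.mem_univ, true_and, LinearMap.mem_ker] at hβ
    rw [amplitude_congr hq hLag fun x hx => ?_]
    have := DFunLike.congr_fun hβ ⟨x, hx⟩
    exact (sub_eq_zero.1 this).symm
  have hnum : (Finset.univ.filter (fun β => α - β ∈ LinearMap.ker R)).card
      = Nat.card (LinearMap.ker R) := by
    rw [← Fintype.card_subtype, ← Nat.card_eq_fintype_card]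
    exact Nat.card_congr ((Equiv.subLeft α).subtypeEquiv fun β => Iff.rfl)
  rw [Finset.sum_congr rfl hamp, Finset.sum_const, hnum, hcard, nsmul_eq_mul]
  push_cast
  ring

end DirichletTerm

/-! ### The number of homomorphisms from `A` to the dual of the Lagrangian subgroup -/

/-- A subgroup of a finite abelian group needs no more generators than the group. -/
theorem exists_generators {D : Type*} [AddCommGroup D] [Finite D] (Lag : AddSubgroup D) :
    ∃ n ≤ AddGroup.rank D, ∃ g : Fin n → Lag, ∀ c : Lag, ∃ v : Fin n → ℤ, ∑ i, v i • g i = c := by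
  obtain ⟨S, hS, hS'⟩ := AddGroup.rank_spec D
  set φ : (S → ℤ) →ₗ[ℤ] D := Fintype.linearCombination ℤ (fun s : S => (s : D)) with hφ
  have hφs : Function.Surjective φ := by
    rw [← LinearMap.range_eq_top, hφ, Fintype.range_linearCombination, Subtype.range_coe_subtype]
    refine Submodule.toAddSubgroup_injective ?_
    rw [Submodule.span_int_eq_addSubgroupClosure, Submodule.top_toAddSubgroup]
    exact hS'
  obtain ⟨n, b⟩ := Submodule.basisOfPid (Pi.basisFun ℤ S)
    ((AddSubgroup.toIntSubmodule Lag).comap φ)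
  refine ⟨n, ?_, fun i => ⟨φ (b i), (b i).2⟩, fun c => ?_⟩
  · have h := (b.linearIndependent.map' _ (Submodule.ker_subtype _)).fintype_card_le_finrank
    simpa [hS] using h
  · obtain ⟨v, hv⟩ := hφs c
    have hv' : v ∈ (AddSubgroup.toIntSubmodule Lag).comap φ := by
      change φ v ∈ Lag
      rw [hv]
      exact c.2
    refine ⟨fun i => b.repr ⟨v, hv'⟩ i, Subtype.ext ?_⟩
    have h := congrArg (φ ∘ₗ Submodule.subtype _) (b.sum_repr ⟨v, hv'⟩)
    rw [map_sum] at h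
    simp only [map_zsmul] at h
    simp only [AddSubgroup.val_finsetSum, AddSubgroup.coe_zsmul]
    rw [← hv]
    exact h

theorem card_ker_restrictTor_le {A E : Type*} [AddCommGroup A] [Module.Finite ℤ A]
    [AddCommGroup E] [Finite E] :
    Nat.card (LinearMap.ker (restrictTor A E)) ≤ Nat.card E ^ Module.finrank ℤ A := by
  obtain ⟨s, hs⟩ := exists_splitting (A := A)
  have hr : Module.finrank ℤ (A ⧸ Submodule.torsion ℤ A) = Module.finrank ℤ A :=
    finrank_quotient_eq_of_le_torsion le_rfl
  have b := Module.finBasisOfFinrankEq ℤ (A ⧸ Submodule.torsion ℤ A) hr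
  have hinj : Function.Injective (fun (h : LinearMap.ker (restrictTor A E)) =>
      fun i => h.1 (s (b i))) := by
    intro h k hk
    have h1 : h.1 ∘ₗ s = k.1 ∘ₗ s := b.ext fun i => congrFun hk i
    have h2 : ∀ h : LinearMap.ker (restrictTor A E), ∀ x,
        h.1 x = h.1 (s (Submodule.Quotient.mk x)) := by
      intro h x
      have hx : x - s (Submodule.Quotient.mk x) ∈ Submodule.torsion ℤ A := by
        rw [← Submodule.Quotient.mk_eq_zero, Submodule.Quotient.mk_sub]
        exact sub_eq_zero.2 (DFunLike.congr_fun hs (Submodule.Quotient.mk x)).symm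
      rw [← sub_eq_zero, ← map_sub]
      exact DFunLike.congr_fun (LinearMap.mem_ker.1 h.2) ⟨_, hx⟩
    refine Subtype.ext (LinearMap.ext fun x => ?_)
    rw [h2 h, h2 k]
    exact DFunLike.congr_fun h1 _
  refine (Nat.card_le_card_of_injective _ hinj).trans ?_
  rw [Nat.card_fun, Nat.card_eq_fintype_card (α := Fin _), Fintype.card_fin]

/-- A homomorphism to `𝔏^*` amounts to a character of `A` for each generator of `𝔏`. -/
theorem card_hom_dual_le {D : Type*} [AddCommGroup D] [Finite D] (Lag : AddSubgroup D)
    {A : Type*} [AddCommGroup A] [Finite A] :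
    Nat.card (A →ₗ[ℤ] (Lag →ₗ[ℤ] QZ)) ≤ Nat.card A ^ AddGroup.rank D := by
  obtain ⟨n, hn, g, hg⟩ := exists_generators Lag
  have hinj : Function.Injective (fun (β : A →ₗ[ℤ] (Lag →ₗ[ℤ] QZ)) => fun i => β.flip (g i)) := by
    intro β γ h
    ext a c
    obtain ⟨v, rfl⟩ := hg c
    have : ∀ i, β a (g i) = γ a (g i) := fun i => DFunLike.congr_fun (congrFun h i) a
    simp [map_sum, this]
  refine (Nat.card_le_card_of_injective _ hinj).trans ?_
  rw [Nat.card_fun, Nat.card_eq_fintype_card (α := Fin _), Fintype.card_fin, card_dual]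
  exact Nat.pow_le_pow_right Nat.card_pos hn

instance finite_tor (X : LinkingPair) : Finite X.Tor :=
  Module.finite_of_fg_torsion _ Submodule.torsion_isTorsion

theorem card_hom_le {D : Type*} [AddCommGroup D] [Finite D] (Lag : AddSubgroup D)
    (X : LinkingPair) : Nat.card (X →ₗ[ℤ] (Lag →ₗ[ℤ] QZ))
      ≤ Nat.card Lag ^ X.rank * Nat.card X.Tor ^ AddGroup.rank D := by
  rw [card_hom_eq]
  refine Nat.mul_le_mul (card_ker_restrictTor_le.trans ?_) ?_
  · rw [card_dual]
    rfl
  · exact card_hom_dual_le Lag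

/-! ### A pair is determined by its rank and its torsion part -/

/-- Some isomorphism of groups carries one bilinear form to the other. -/
def Isometric {A B : Type*} [AddCommGroup A] [AddCommGroup B] (ℓ : A →ₗ[ℤ] A →ₗ[ℤ] QZ)
    (ℓ' : B →ₗ[ℤ] B →ₗ[ℤ] QZ) : Prop :=
  ∃ φ : A ≃+ B, ∀ x y, ℓ' (φ x) (φ y) = ℓ x y

theorem exists_split_equiv (A : Type*) [AddCommGroup A] [Module.Finite ℤ A] :
    ∃ φ : A ≃+ Submodule.torsion ℤ A × (A ⧸ Submodule.torsion ℤ A),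
      ∀ x : Submodule.torsion ℤ A, φ x = (x, 0) := by
  obtain ⟨r, hr⟩ := exists_retraction (A := A)
  have h0 : ∀ x : Submodule.torsion ℤ A, (Submodule.torsion ℤ A).mkQ (x : A) = 0 := fun x =>
    (Submodule.Quotient.mk_eq_zero _).2 x.2
  have hbij : Function.Bijective (r.prod (Submodule.torsion ℤ A).mkQ) := by
    constructor
    · rw [← LinearMap.ker_eq_bot, LinearMap.ker_eq_bot']
      intro x hx
      obtain ⟨hx1, hx3⟩ : r x = 0 ∧ (Submodule.torsion ℤ A).mkQ x = 0 := Prod.mk_eq_zero.1 hx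
      have hx2 : x ∈ Submodule.torsion ℤ A := (Submodule.Quotient.mk_eq_zero _).1 hx3
      have := hr ⟨x, hx2⟩
      rw [hx1] at this
      exact (congrArg Subtype.val this).symm
    · rintro ⟨t, u⟩
      obtain ⟨a, rfl⟩ := Submodule.mkQ_surjective _ u
      refine ⟨a - r a + t, Prod.ext ?_ ?_⟩
      · change r (a - r a + t) = t
        rw [map_add, map_sub, hr, hr, sub_self, zero_add]
      · change (Submodule.torsion ℤ A).mkQ (a - r a + t) = _
        rw [map_add, map_sub, h0, h0, sub_zero, add_zero]
  refine ⟨AddEquiv.ofBijective (r.prod (Submodule.torsion ℤ A).mkQ) hbij, fun x => ?_⟩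
  exact Prod.ext (hr x) (h0 x)

theorem LinkingPair.equivalent_of_isometric {X Y : LinkingPair} (hr : X.rank = Y.rank)
    (h : Isometric X.form Y.form) : X.Equivalent Y := by
  obtain ⟨t, ht⟩ := h
  obtain ⟨φ, hφ⟩ := exists_split_equiv X
  obtain ⟨ψ, hψ⟩ := exists_split_equiv Y
  have hr' : Module.finrank ℤ (X ⧸ Submodule.torsion ℤ X)
      = Module.finrank ℤ (Y ⧸ Submodule.torsion ℤ Y) := by
    rw [finrank_quotient_eq_of_le_torsion le_rfl, finrank_quotient_eq_of_le_torsion le_rfl]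
    exact hr
  have ε := LinearEquiv.ofFinrankEq (R := ℤ) _ _ hr'
  refine ⟨(φ.trans (t.prodCongr ε.toAddEquiv)).trans ψ.symm, ?_⟩
  have key : ∀ x : X.Tor, ((φ.trans (t.prodCongr ε.toAddEquiv)).trans ψ.symm) x = (t x : Y) := by
    intro x
    rw [AddEquiv.trans_apply, AddEquiv.symm_apply_eq, hψ, AddEquiv.trans_apply, hφ]
    exact Prod.ext rfl (map_zero ε)
  intro x y x' y' hx hy
  rw [key] at hx hy
  rw [← Subtype.ext hx, ← Subtype.ext hy, ht]

theorem mem_torsion_of_finite {A : Type*} [AddCommGroup A] [Finite A] (y : A) :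
    y ∈ Submodule.torsion ℤ A :=
  mem_torsion_int.2 ⟨Nat.card A, by exact_mod_cast Nat.card_pos.ne', by simp⟩

/-- A nondegenerate symmetric form on a finite group, as a pair of rank zero. -/
def LinkingPair.ofFinite {A : Type} [AddCommGroup A] [Finite A] (ℓ : A →ₗ[ℤ] A →ₗ[ℤ] QZ)
    (symm : ∀ x y, ℓ x y = ℓ y x) (nondeg : ∀ x, (∀ y, ℓ x y = 0) → x = 0) : LinkingPair where
  carrier := A
  finite := Module.Finite.of_finite
  form := ℓ.compl₁₂ (Submodule.torsion ℤ A).subtype (Submodule.torsion ℤ A).subtype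
  symm x y := symm x y
  nondegenerate x hx := Subtype.ext (nondeg x fun y => hx ⟨y, mem_torsion_of_finite y⟩)

/-- The pair of rank zero formed by `Tor A` and `ℓ`. -/
def LinkingPair.torsionPart (X : LinkingPair) : LinkingPair :=
  LinkingPair.ofFinite (A := X.Tor) X.form X.symm X.nondegenerate

theorem LinkingPair.isometric_of_torsionPart_equivalent {X Y : LinkingPair}
    (h : X.torsionPart.Equivalent Y.torsionPart) : Isometric X.form Y.form := by
  obtain ⟨φ, hφ⟩ := h
  refine ⟨φ, fun x y => ?_⟩
  have hX : ∀ x : X.torsionPart, x ∈ X.torsionPart.Tor := mem_torsion_of_finite (A := X.Tor)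
  have hY : ∀ x : Y.torsionPart, x ∈ Y.torsionPart.Tor := mem_torsion_of_finite (A := Y.Tor)
  exact (hφ ⟨x, hX x⟩ ⟨y, hX y⟩ ⟨φ x, hY _⟩ ⟨φ y, hY _⟩ rfl rfl).symm

/-! ### Orthogonal decompositions of finite forms -/

/-- The element `u/n` of `ℚ/ℤ`, additively in `u`. -/
def frac (n : ℕ) : ℤ →+ QZ := zmultiplesHom QZ ((1 / (n : ℚ) : ℚ) : QZ)

theorem zsmul_frac (n : ℕ) (z u : ℤ) : z • frac n u = frac n (z * u) := by
  rw [← map_zsmul, smul_eq_mul]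

theorem frac_eq_zero_iff {n : ℕ} (hn : 0 < n) {u : ℤ} : frac n u = 0 ↔ (n : ℤ) ∣ u := by
  rw [frac, zmultiplesHom_apply, ← addOrderOf_dvd_iff_zsmul_eq_zero,
    AddCircle.addOrderOf_period_div hn]

theorem frac_eq_of_modEq {n : ℕ} (hn : 0 < n) {u v : ℤ} (h : u ≡ v [ZMOD n]) :
    frac n u = frac n v := by
  rw [← sub_eq_zero, ← map_sub, frac_eq_zero_iff hn]
  exact h.symm.dvd

theorem exists_eq_frac {n : ℕ} (hn : 0 < n) {w : QZ} (hw : n • w = 0) :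
    ∃ u : ℕ, u < n ∧ w = frac n u := by
  obtain ⟨u, hu, h⟩ := (AddCircle.nsmul_eq_zero_iff hn).1 hw
  refine ⟨u, hu, h.symm.trans ?_⟩
  rw [frac, zmultiplesHom_apply, ← AddCircle.coe_zsmul]
  congr 1
  simp [div_eq_mul_inv]

section Forms

variable {A B : Type*} [AddCommGroup A] [AddCommGroup B]

/-- A nondegenerate form is determined by the Gram matrix of a generating family. -/
theorem isometric_of_gram {ι : Type*} [Fintype ι] {ℓ : A →ₗ[ℤ] A →ₗ[ℤ] QZ}
    {ℓ' : B →ₗ[ℤ] B →ₗ[ℤ] QZ} (hℓ : ∀ x, (∀ y, ℓ x y = 0) → x = 0)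
    (hℓ' : ∀ x, (∀ y, ℓ' x y = 0) → x = 0) {g : ι → A} {g' : ι → B}
    (hg : ∀ x, ∃ v : ι → ℤ, ∑ i, v i • g i = x) (hg' : ∀ x, ∃ v : ι → ℤ, ∑ i, v i • g' i = x)
    (h : ∀ i j, ℓ (g i) (g j) = ℓ' (g' i) (g' j)) : Isometric ℓ ℓ' := by
  set F := Fintype.linearCombination ℤ g with hF
  set F' := Fintype.linearCombination ℤ g' with hF'
  have hFs : Function.Surjective F := hg
  have hFs' : Function.Surjective F' := hg'
  have hform : ∀ v w, ℓ (F v) (F w) = ℓ' (F' v) (F' w) := by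
    intro v w
    simp only [hF, hF', Fintype.linearCombination_apply, map_sum, LinearMap.sum_apply, map_zsmul,
      LinearMap.smul_apply, h]
  have hker : LinearMap.ker F = LinearMap.ker F' := by
    ext v
    rw [LinearMap.mem_ker, LinearMap.mem_ker]
    constructor
    · intro hv
      refine hℓ' _ fun y => ?_
      obtain ⟨w, rfl⟩ := hFs' y
      rw [← hform, hv, map_zero, LinearMap.zero_apply]
    · intro hv
      refine hℓ _ fun y => ?_
      obtain ⟨w, rfl⟩ := hFs y
      rw [hform, hv, map_zero, LinearMap.zero_apply]
  set φ := (F.quotKerEquivOfSurjective hFs).symm.trans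
    ((Submodule.quotEquivOfEq _ _ hker).trans (F'.quotKerEquivOfSurjective hFs')) with hφ
  have hφF : ∀ v, φ (F v) = F' v := by
    intro v
    have h1 : (F.quotKerEquivOfSurjective hFs).symm (F v) = Submodule.Quotient.mk v := by
      rw [LinearEquiv.symm_apply_eq]
      rfl
    rw [hφ, LinearEquiv.trans_apply, h1]
    rfl
  refine ⟨φ.toAddEquiv, fun x y => ?_⟩
  obtain ⟨v, rfl⟩ := hFs x
  obtain ⟨w, rfl⟩ := hFs y
  change ℓ' (φ (F v)) (φ (F w)) = _
  rw [hφF, hφF, hform]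

/-- The orthogonal complement of a subgroup. -/
def orthogonal (ℓ : A →ₗ[ℤ] A →ₗ[ℤ] QZ) (U : Submodule ℤ A) : Submodule ℤ A where
  carrier := {x | ∀ y ∈ U, ℓ x y = 0}
  add_mem' hx hy z hz := by rw [map_add, LinearMap.add_apply, hx z hz, hy z hz, add_zero]
  zero_mem' z _ := by rw [map_zero, LinearMap.zero_apply]
  smul_mem' n x hx z hz := by rw [map_smul, LinearMap.smul_apply, hx z hz, smul_zero]

variable [Finite A] {ℓ : A →ₗ[ℤ] A →ₗ[ℤ] QZ} {U : Submodule ℤ A}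

/-- A subgroup on which the form is nondegenerate is an orthogonal summand. -/
theorem exists_sub_mem_orthogonal (hU : ∀ x ∈ U, (∀ y ∈ U, ℓ x y = 0) → x = 0) (z : A) :
    ∃ x ∈ U, z - x ∈ orthogonal ℓ U := by
  set F : U →ₗ[ℤ] (U →ₗ[ℤ] QZ) := ℓ.compl₁₂ U.subtype U.subtype with hF
  have hinj : Function.Injective F := by
    rw [← LinearMap.ker_eq_bot, LinearMap.ker_eq_bot']
    intro x hx
    exact Subtype.ext (hU x x.2 fun y hy => DFunLike.congr_fun hx ⟨y, hy⟩)
  have hbij : Function.Bijective F :=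
    (Nat.bijective_iff_injective_and_card _).2 ⟨hinj, card_dual.symm⟩
  obtain ⟨x, hx⟩ := hbij.2 (ℓ z ∘ₗ U.subtype)
  refine ⟨x, x.2, fun y hy => ?_⟩
  rw [map_sub, LinearMap.sub_apply, sub_eq_zero]
  exact (DFunLike.congr_fun hx ⟨y, hy⟩).symm

theorem card_mul_card_orthogonal_le (hU : ∀ x ∈ U, (∀ y ∈ U, ℓ x y = 0) → x = 0) :
    Nat.card U * Nat.card (orthogonal ℓ U) ≤ Nat.card A := by
  rw [← Nat.card_prod]
  refine Nat.card_le_card_of_injective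
    (fun t : U × orthogonal ℓ U => (t.1 : A) + (t.2 : A)) ?_
  rintro ⟨x, y⟩ ⟨x', y'⟩ h
  simp only at h
  have h1 : (x : A) - x' = y' - y := by
    rw [sub_eq_sub_iff_add_eq_add, h, add_comm]
  have h2 : (x : A) - x' = 0 := by
    refine hU _ (sub_mem x.2 x'.2) ?_
    rw [h1]
    exact (orthogonal ℓ U).sub_mem y'.2 y.2
  have h3 : x = x' := Subtype.ext (sub_eq_zero.1 h2)
  refine Prod.ext h3 (Subtype.ext ?_)
  rw [h2] at h1
  exact (sub_eq_zero.1 h1.symm).symm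

theorem orthogonal_nondegenerate (hℓ : ∀ x, (∀ y, ℓ x y = 0) → x = 0)
    (hU : ∀ x ∈ U, (∀ y ∈ U, ℓ x y = 0) → x = 0) {x : A} (hx : x ∈ orthogonal ℓ U)
    (h : ∀ y ∈ orthogonal ℓ U, ℓ x y = 0) : x = 0 := by
  refine hℓ x fun z => ?_
  obtain ⟨y, hy, hzy⟩ := exists_sub_mem_orthogonal hU z
  have h1 := h _ hzy
  rw [map_sub, hx y hy, sub_zero] at h1
  exact h1

end Forms

/-! ### Blocks -/

/-- Representative of the nontrivial class of units modulo squares, for moduli with at most two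
such classes. -/
def unitClass (n : ℕ) : ℤ := by
  classical
  exact if h : ∃ ε : ℤ, ∀ u : ℤ, IsCoprime u n →
      ∃ i : ℤ, IsCoprime i n ∧ (i * i * u ≡ 1 [ZMOD n] ∨ i * i * u ≡ ε [ZMOD n])
    then h.choose else 1

/-- Modulo an odd prime power the units form a cyclic group, so that the squares have index at most
two. -/
theorem unitClass_spec {p k : ℕ} (hp : p.Prime) (hp2 : p ≠ 2) (u : ℤ)
    (hu : IsCoprime u ((p ^ k : ℕ) : ℤ)) :
    ∃ i : ℤ, IsCoprime i ((p ^ k : ℕ) : ℤ) ∧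
      (i * i * u ≡ 1 [ZMOD (p ^ k : ℕ)] ∨ i * i * u ≡ unitClass (p ^ k) [ZMOD (p ^ k : ℕ)]) := by
  have h : ∃ ε : ℤ, ∀ u : ℤ, IsCoprime u ((p ^ k : ℕ) : ℤ) →
      ∃ i : ℤ, IsCoprime i ((p ^ k : ℕ) : ℤ) ∧
        (i * i * u ≡ 1 [ZMOD (p ^ k : ℕ)] ∨ i * i * u ≡ ε [ZMOD (p ^ k : ℕ)]) := by
    have hcyc := ZMod.isCyclic_units_of_prime_pow p hp hp2 k
    have : NeZero (p ^ k) := ⟨pow_ne_zero _ hp.ne_zero⟩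
    obtain ⟨γ, hγ⟩ := hcyc.exists_generator
    have hcast : ∀ v : (ZMod (p ^ k))ˣ, (((v : ZMod (p ^ k)).val : ℤ) : ZMod (p ^ k)) = v := by
      intro v
      simp
    have hcop : ∀ v : (ZMod (p ^ k))ˣ,
        IsCoprime ((v : ZMod (p ^ k)).val : ℤ) ((p ^ k : ℕ) : ℤ) := fun v =>
      Nat.isCoprime_iff_coprime.2 (ZMod.val_coe_unit_coprime v)
    refine ⟨((γ : ZMod (p ^ k)).val : ℤ), fun u hu => ?_⟩
    have hunit : IsUnit (u : ZMod (p ^ k)) := (ZMod.coe_int_isUnit_iff_isCoprime u (p ^ k)).2 hu.symm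
    obtain ⟨w, hw⟩ := hunit
    obtain ⟨s, hs⟩ := hγ w
    simp only at hs
    rcases Int.even_or_odd' s with ⟨r, hr | hr⟩
    · refine ⟨((γ ^ (-r) : (ZMod (p ^ k))ˣ) : ZMod (p ^ k)).val, hcop _, Or.inl ?_⟩
      rw [← ZMod.intCast_eq_intCast_iff, Int.cast_mul, Int.cast_mul, hcast, ← hw, ← hs,
        Int.cast_one, ← Units.val_mul, ← Units.val_mul, ← zpow_add, ← zpow_add, hr]
      simp [two_mul]
    · refine ⟨((γ ^ (-r) : (ZMod (p ^ k))ˣ) : ZMod (p ^ k)).val, hcop _, Or.inr ?_⟩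
      rw [← ZMod.intCast_eq_intCast_iff, Int.cast_mul, Int.cast_mul, hcast, ← hw, ← hs,
        hcast, ← Units.val_mul, ← Units.val_mul, ← zpow_add, ← zpow_add, hr]
      have : -r + -r + (2 * r + 1) = 1 := by ring
      rw [this, zpow_one]
  unfold unitClass
  rw [dif_pos h]
  exact h.choose_spec u hu

/-- Types of the blocks of an orthogonal decomposition: a cyclic group `ℤ/(n+2)` with one of two
forms, a cyclic group of order `2^(k+1)` with generator of square `u/2^(k+1)`, or a group
`(ℤ/2^(k+1))²` with Gram matrix `((a, 1), (1, d))/2^(k+1)`. -/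
abbrev BlockType : Type :=
  (ℕ × Bool) ⊕ ((Σ k : ℕ, Fin (2 ^ (k + 1))) ⊕ (Σ k : ℕ, Fin (2 ^ (k + 1)) × Fin (2 ^ (k + 1))))

/-- The order of a block. -/
def blockSize : BlockType → ℕ
  | Sum.inl t => t.1 + 2
  | Sum.inr (Sum.inl t) => 2 ^ (t.1 + 1)
  | Sum.inr (Sum.inr t) => (2 ^ (t.1 + 1)) ^ 2

/-- The Gram matrix of a block; the second generator of a cyclic block is zero. -/
def blockGram : BlockType → Matrix (Fin 2) (Fin 2) QZ
  | Sum.inl (n, true) => !![frac (n + 2) 1, 0; 0, 0]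
  | Sum.inl (n, false) => !![frac (n + 2) (unitClass (n + 2)), 0; 0, 0]
  | Sum.inr (Sum.inl ⟨k, u⟩) => !![frac (2 ^ (k + 1)) (u : ℕ), 0; 0, 0]
  | Sum.inr (Sum.inr ⟨k, a, d⟩) =>
    !![frac (2 ^ (k + 1)) (a : ℕ), frac (2 ^ (k + 1)) 1;
      frac (2 ^ (k + 1)) 1, frac (2 ^ (k + 1)) (d : ℕ)]

theorem two_le_blockSize (t : BlockType) : 2 ≤ blockSize t := by
  rcases t with t | t | t
  · simp [blockSize]
  · simp only [blockSize]
    calc 2 = 2 ^ 1 := rfl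
      _ ≤ _ := Nat.pow_le_pow_right (by norm_num) (by omega)
  · simp only [blockSize, ← pow_mul]
    calc 2 = 2 ^ 1 := rfl
      _ ≤ _ := Nat.pow_le_pow_right (by norm_num) (by omega)

section Blocks

variable {A : Type*} [AddCommGroup A]

/-- The family `g` generates a nondegenerate subgroup with the Gram matrix of a block of type
`t`. -/
structure IsBlock (ℓ : A →ₗ[ℤ] A →ₗ[ℤ] QZ) (t : BlockType) (g : Fin 2 → A) : Prop where
  gram : ∀ a b, ℓ (g a) (g b) = blockGram t a b
  nondegenerate : ∀ x ∈ Submodule.span ℤ (Set.range g),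
    (∀ y ∈ Submodule.span ℤ (Set.range g), ℓ x y = 0) → x = 0
  size_le : blockSize t ≤ Nat.card (Submodule.span ℤ (Set.range g))

theorem isBlock_of_cyclic [Finite A] {ℓ : A →ₗ[ℤ] A →ₗ[ℤ] QZ} {t : BlockType} {z : A} {n : ℕ}
    {u : ℤ} (hn : 0 < n) (hz : n • z = 0) (hu : IsCoprime u n) (hzz : ℓ z z = frac n u)
    (hgram : blockGram t = !![frac n u, 0; 0, 0]) (hsize : blockSize t = n) :
    IsBlock ℓ t ![z, 0] := by
  have hz' : z ∈ Submodule.span ℤ (Set.range ![z, (0 : A)]) := Submodule.subset_span ⟨0, rfl⟩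
  have hdvd : ∀ i : ℤ, i • ℓ z z = 0 → (n : ℤ) ∣ i := by
    intro i hi
    rw [hzz, zsmul_frac, frac_eq_zero_iff hn] at hi
    exact hu.symm.dvd_of_dvd_mul_right hi
  refine ⟨fun a b => ?_, fun x hx h => ?_, ?_⟩
  · rw [hgram]
    fin_cases a <;> fin_cases b <;> simp [hzz]
  · obtain ⟨v, rfl⟩ := (Submodule.mem_span_range_iff_exists_fun ℤ).1 hx
    simp only [Fin.sum_univ_two, Matrix.cons_val_zero, Matrix.cons_val_one, smul_zero,
      add_zero] at h ⊢
    have h1 := h z hz'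
    rw [map_zsmul, LinearMap.smul_apply] at h1
    obtain ⟨c, hc⟩ := hdvd _ h1
    rw [hc, mul_comm, mul_smul, natCast_zsmul, hz, smul_zero]
  · rw [hsize]
    have hinj : Function.Injective (fun i : Fin n =>
        (⟨((i : ℕ) : ℤ) • z, Submodule.smul_mem _ _ hz'⟩ :
          Submodule.span ℤ (Set.range ![z, (0 : A)]))) := by
      intro i j hij
      have h1 : ((i : ℕ) : ℤ) • z = ((j : ℕ) : ℤ) • z := congrArg Subtype.val hij
      have h2 : (((i : ℕ) : ℤ) - ((j : ℕ) : ℤ)) • ℓ z z = 0 := by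
        rw [← LinearMap.smul_apply, ← map_zsmul, sub_smul, h1, sub_self, map_zero,
          LinearMap.zero_apply]
      have h3 := hdvd _ h2
      have h4 := (Int.modEq_iff_dvd.2 h3)
      exact Fin.ext (Nat.ModEq.eq_of_lt_of_lt (Int.natCast_modEq_iff.1 h4) j.2 i.2).symm
    simpa using Nat.card_le_card_of_injective _ hinj

theorem isBlock_of_plane [Finite A] {ℓ : A →ₗ[ℤ] A →ₗ[ℤ] QZ} (symm : ∀ x y, ℓ x y = ℓ y x)
    {x y : A} {k : ℕ} (hx : 2 ^ (k + 1) • x = 0) (hy : 2 ^ (k + 1) • y = 0)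
    {a d : Fin (2 ^ (k + 1))} (hxx : ℓ x x = frac (2 ^ (k + 1)) (a : ℕ))
    (hxy : ℓ x y = frac (2 ^ (k + 1)) 1) (hyy : ℓ y y = frac (2 ^ (k + 1)) (d : ℕ))
    (ha : Even (a : ℕ)) : IsBlock ℓ (Sum.inr (Sum.inr ⟨k, a, d⟩)) ![x, y] := by
  have hn : 0 < 2 ^ (k + 1) := by positivity
  have hx' : x ∈ Submodule.span ℤ (Set.range ![x, y]) := Submodule.subset_span ⟨0, rfl⟩
  have hy' : y ∈ Submodule.span ℤ (Set.range ![x, y]) := Submodule.subset_span ⟨1, rfl⟩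
  have hyx : ℓ y x = frac (2 ^ (k + 1)) 1 := by rw [symm, hxy]
  -- The determinant `a d - 1` is odd.
  have hdvd : ∀ i j : ℤ, ℓ (i • x + j • y) x = 0 → ℓ (i • x + j • y) y = 0 →
      ((2 ^ (k + 1) : ℕ) : ℤ) ∣ i ∧ ((2 ^ (k + 1) : ℕ) : ℤ) ∣ j := by
    intro i j h1 h2
    rw [map_add, LinearMap.add_apply, map_zsmul, map_zsmul, LinearMap.smul_apply,
      LinearMap.smul_apply, hxx, hyx, zsmul_frac, zsmul_frac, ← map_add, mul_one] at h1
    rw [map_add, LinearMap.add_apply, map_zsmul, map_zsmul, LinearMap.smul_apply,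
      LinearMap.smul_apply, hxy, hyy, zsmul_frac, zsmul_frac, ← map_add, mul_one] at h2
    rw [frac_eq_zero_iff hn] at h1 h2
    have h3 : ((2 ^ (k + 1) : ℕ) : ℤ) ∣ j * (1 - (a : ℕ) * (d : ℕ)) := by
      have : j * (1 - ((a : ℕ) : ℤ) * (d : ℕ))
          = (i * (a : ℕ) + j) - (i + j * (d : ℕ)) * (a : ℕ) := by ring
      rw [this]
      exact dvd_sub h1 (Dvd.dvd.mul_right h2 _)
    have hodd : Odd (1 - ((a : ℕ) : ℤ) * (d : ℕ)) := by
      have : Even (((a : ℕ) : ℤ) * (d : ℕ)) := ((Int.even_coe_nat _).2 ha).mul_right _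
      exact odd_one.sub_even this
    have hcop : IsCoprime ((2 ^ (k + 1) : ℕ) : ℤ) (1 - ((a : ℕ) : ℤ) * (d : ℕ)) := by
      push_cast
      exact (Int.isCoprime_two_left.2 hodd).pow_left
    have h4 : ((2 ^ (k + 1) : ℕ) : ℤ) ∣ j := hcop.dvd_of_dvd_mul_right h3
    refine ⟨?_, h4⟩
    exact (dvd_add_left (h4.mul_right _)).1 h2
  refine ⟨fun b c => ?_, fun z hz h => ?_, ?_⟩
  · fin_cases b <;> fin_cases c <;> simp [blockGram, hxx, hxy, hyx, hyy]
  · obtain ⟨v, rfl⟩ := (Submodule.mem_span_range_iff_exists_fun ℤ).1 hz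
    simp only [Fin.sum_univ_two, Matrix.cons_val_zero, Matrix.cons_val_one] at h ⊢
    obtain ⟨⟨c, hc⟩, ⟨c', hc'⟩⟩ := hdvd _ _ (h x hx') (h y hy')
    rw [hc, hc', mul_comm, mul_smul, mul_comm, mul_smul, natCast_zsmul, natCast_zsmul, hx, hy,
      smul_zero, smul_zero, add_zero]
  · have hinj : Function.Injective (fun t : Fin (2 ^ (k + 1)) × Fin (2 ^ (k + 1)) =>
        (⟨((t.1 : ℕ) : ℤ) • x + ((t.2 : ℕ) : ℤ) • y,
          add_mem (Submodule.smul_mem _ _ hx') (Submodule.smul_mem _ _ hy')⟩ :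
          Submodule.span ℤ (Set.range ![x, y]))) := by
      rintro ⟨i, j⟩ ⟨i', j'⟩ hij
      have h1 : ((i : ℕ) : ℤ) • x + ((j : ℕ) : ℤ) • y
          = ((i' : ℕ) : ℤ) • x + ((j' : ℕ) : ℤ) • y := congrArg Subtype.val hij
      have h2 : (((i : ℕ) : ℤ) - ((i' : ℕ) : ℤ)) • x + (((j : ℕ) : ℤ) - ((j' : ℕ) : ℤ)) • y = 0 := by
        rw [sub_smul, sub_smul, sub_add_sub_comm, h1, sub_self]
      obtain ⟨h3, h4⟩ := hdvd _ _ (by rw [h2, map_zero, LinearMap.zero_apply])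
        (by rw [h2, map_zero, LinearMap.zero_apply])
      have h5 := Int.natCast_modEq_iff.1 (Int.modEq_iff_dvd.2 h3)
      have h6 := Int.natCast_modEq_iff.1 (Int.modEq_iff_dvd.2 h4)
      exact Prod.ext (Fin.ext (Nat.ModEq.eq_of_lt_of_lt h5 i'.2 i.2).symm)
        (Fin.ext (Nat.ModEq.eq_of_lt_of_lt h6 j'.2 j.2).symm)
    have := Nat.card_le_card_of_injective _ hinj
    rw [Nat.card_prod, Nat.card_eq_fintype_card, Fintype.card_fin, ← sq] at this
    exact this

theorem eq_zero_of_coprime_smul {M : Type*} [AddCommGroup M] {w : M} {a b : ℤ} (h : IsCoprime a b)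
    (ha : a • w = 0) (hb : b • w = 0) : w = 0 := by
  obtain ⟨u, v, huv⟩ := h
  rw [← one_zsmul w, ← huv, add_smul, mul_smul, mul_smul, ha, hb, smul_zero, smul_zero, add_zero]

/-- Let `p^(k+1)` be the exponent of the `p`-primary part of `A`. By nondegeneracy, there are two
elements of the `p`-primary part whose product in `ℚ/ℤ` has the full order `p^(k+1)`. -/
theorem exists_pair_of_max_order [Finite A] {ℓ : A →ₗ[ℤ] A →ₗ[ℤ] QZ}
    (hℓ : ∀ x, (∀ y, ℓ x y = 0) → x = 0) {p : ℕ} (hp : p.Prime) (hpA : p ∣ Nat.card A) :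
    ∃ (k : ℕ) (x y : A), p ^ (k + 1) • x = 0 ∧ p ^ (k + 1) • y = 0 ∧ p ^ k • ℓ x y ≠ 0 := by
  classical
  have hN : Nat.card A ≠ 0 := Nat.card_pos.ne'
  have hsplit : ∃ k, ∀ (z : A) (a : ℕ), p ^ a • z = 0 → p ^ k • z = 0 := by
    refine ⟨Nat.card A, fun z a hz => ?_⟩
    obtain ⟨b, -, hb⟩ := (Nat.dvd_prime_pow hp).1 (addOrderOf_dvd_of_nsmul_eq_zero hz)
    refine addOrderOf_dvd_iff_nsmul_eq_zero.1 ?_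
    rw [hb]
    refine pow_dvd_pow p ?_
    have h1 : p ^ b ≤ Nat.card A := by
      rw [← hb]
      exact Nat.le_of_dvd Nat.card_pos (addOrderOf_dvd_natCard z)
    exact ((Nat.lt_pow_self hp.one_lt).trans_le h1).le
  have hmax := Nat.find_spec hsplit
  rcases hk : Nat.find hsplit with _ | k
  · exfalso
    obtain ⟨z, hz⟩ := exists_prime_addOrderOf_dvd_card' (G := A) p (hp := ⟨hp⟩) hpA
    have h1 := hmax z 1 (by rw [pow_one, ← hz, addOrderOf_nsmul_eq_zero])
    rw [hk, pow_zero, one_smul] at h1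
    rw [h1, addOrderOf_zero] at hz
    exact hp.one_lt.ne hz
  · rw [hk] at hmax
    have hnot := Nat.find_min hsplit (m := k) (by omega)
    push Not at hnot
    obtain ⟨x, a, hxa, hx⟩ := hnot
    have hx0 : p ^ (k + 1) • x = 0 := hmax x a hxa
    have hex : ∃ y, ℓ (p ^ k • x) y ≠ 0 := by
      by_contra hcon
      push Not at hcon
      exact hx (hℓ _ hcon)
    obtain ⟨y, hy⟩ := hex
    obtain ⟨e, r, hr, her⟩ := Nat.exists_eq_pow_mul_and_not_dvd hN p hp.ne_one
    have hry : p ^ (k + 1) • (r • y) = 0 := by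
      refine hmax _ e ?_
      rw [← mul_smul, ← her]
      exact card_nsmul_eq_zero'
    refine ⟨k, x, r • y, hx0, hry, fun h => hy ?_⟩
    have hcop : IsCoprime (r : ℤ) (p : ℤ) :=
      Nat.isCoprime_iff_coprime.2 ((Nat.Prime.coprime_iff_not_dvd hp).2 hr).symm
    refine eq_zero_of_coprime_smul hcop ?_ ?_
    · rw [natCast_zsmul, map_nsmul, LinearMap.smul_apply, smul_comm]
      rwa [map_nsmul] at h
    · rw [natCast_zsmul, ← LinearMap.smul_apply, ← map_nsmul, ← mul_smul, ← pow_succ', hx0,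
        map_zero, LinearMap.zero_apply]

theorem isCoprime_of_smul_frac_ne_zero {p k : ℕ} (hp : p.Prime) {u : ℤ}
    (h : p ^ k • frac (p ^ (k + 1)) u ≠ 0) : IsCoprime u ((p ^ (k + 1) : ℕ) : ℤ) := by
  push_cast
  refine IsCoprime.pow_right ?_
  refine ((Nat.prime_iff_prime_int.1 hp).irreducible.coprime_iff_not_dvd.2 fun hdvd => h ?_).symm
  rw [← natCast_zsmul, zsmul_frac, frac_eq_zero_iff (pow_pos hp.pos _)]
  push_cast
  rw [pow_succ]
  exact mul_dvd_mul_left _ hdvd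

theorem even_of_smul_frac_eq_zero {k u : ℕ} (h : 2 ^ k • frac (2 ^ (k + 1)) (u : ℤ) = 0) :
    Even u := by
  rw [← natCast_zsmul, zsmul_frac, frac_eq_zero_iff (by positivity)] at h
  push_cast at h
  rw [pow_succ] at h
  have := Int.dvd_of_mul_dvd_mul_left (by positivity) h
  exact even_iff_two_dvd.2 (by exact_mod_cast this)

/-- An element whose square has the full order `p^(k+1)` generates a cyclic block; for odd `p` it is
rescaled to make the square one of two normal forms. -/
theorem exists_block_of_order [Finite A] {ℓ : A →ₗ[ℤ] A →ₗ[ℤ] QZ} {p k : ℕ} (hp : p.Prime) {z : A}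
    (hz : p ^ (k + 1) • z = 0) (hzz : p ^ k • ℓ z z ≠ 0) : ∃ t g, IsBlock ℓ t g := by
  have hn : 0 < p ^ (k + 1) := pow_pos hp.pos _
  obtain ⟨u, hu, huz⟩ := exists_eq_frac (w := ℓ z z) hn (by
    rw [← LinearMap.smul_apply, ← map_nsmul, hz, map_zero, LinearMap.zero_apply])
  have hcop : IsCoprime (u : ℤ) ((p ^ (k + 1) : ℕ) : ℤ) :=
    isCoprime_of_smul_frac_ne_zero hp (by rwa [← huz])
  by_cases hp2 : p = 2
  · subst hp2
    exact ⟨Sum.inr (Sum.inl ⟨k, ⟨u, hu⟩⟩), _, isBlock_of_cyclic hn hz hcop huz rfl rfl⟩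
  · obtain ⟨i, hi, hiu⟩ := unitClass_spec hp hp2 u hcop
    obtain ⟨n, hn2⟩ : ∃ n, p ^ (k + 1) = n + 2 := by
      have : 2 ≤ p ^ (k + 1) := hp.two_le.trans (Nat.le_self_pow (by omega) p)
      exact ⟨p ^ (k + 1) - 2, by omega⟩
    have hiz : p ^ (k + 1) • (i • z) = 0 := by rw [smul_comm, hz, smul_zero]
    have hform : ℓ (i • z) (i • z) = frac (p ^ (k + 1)) (i * i * u) := by
      rw [map_zsmul, map_zsmul, LinearMap.smul_apply, huz, zsmul_frac, zsmul_frac, mul_assoc]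
    have hc : IsCoprime (i * i * u) ((p ^ (k + 1) : ℕ) : ℤ) := (hi.mul_left hi).mul_left hcop
    rcases hiu with h1 | h1
    · have h2 := frac_eq_of_modEq hn h1
      refine ⟨Sum.inl (n, true), _, isBlock_of_cyclic hn hiz hc hform ?_ hn2.symm⟩
      rw [h2, hn2]
      rfl
    · have h2 := frac_eq_of_modEq hn h1
      refine ⟨Sum.inl (n, false), _, isBlock_of_cyclic hn hiz hc hform ?_ hn2.symm⟩
      rw [h2, hn2]
      rfl

/-- A nondegenerate form on a nontrivial finite group contains a block. If `ℓ(x, y)` has full order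
but none of `x`, `y`, `x + y` has a square of full order, then `p = 2` and `x`, `y` span a plane. -/
theorem exists_block [Finite A] [Nontrivial A] {ℓ : A →ₗ[ℤ] A →ₗ[ℤ] QZ}
    (symm : ∀ x y, ℓ x y = ℓ y x) (hℓ : ∀ x, (∀ y, ℓ x y = 0) → x = 0) :
    ∃ t g, IsBlock ℓ t g := by
  obtain ⟨p, hp, hpA⟩ := Nat.exists_prime_and_dvd (Finite.one_lt_card (α := A)).ne'
  obtain ⟨k, x, y, hx, hy, hxy⟩ := exists_pair_of_max_order hℓ hp hpA
  have hn : 0 < p ^ (k + 1) := pow_pos hp.pos _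
  by_cases hxx : p ^ k • ℓ x x ≠ 0
  · exact exists_block_of_order hp hx hxx
  by_cases hyy : p ^ k • ℓ y y ≠ 0
  · exact exists_block_of_order hp hy hyy
  by_cases hzz : p ^ k • ℓ (x + y) (x + y) ≠ 0
  · exact exists_block_of_order hp (by rw [smul_add, hx, hy, add_zero]) hzz
  push Not at hxx hyy hzz
  have htor : ∀ z w : A, p ^ (k + 1) • z = 0 → p ^ (k + 1) • ℓ z w = 0 := fun z w hz => by
    rw [← LinearMap.smul_apply, ← map_nsmul, hz, map_zero, LinearMap.zero_apply]
  have hp2 : p = 2 := by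
    by_contra hne
    have h2 : (2 : ℤ) • (p ^ k • ℓ x y) = 0 := by
      simp only [map_add, LinearMap.add_apply, smul_add, hxx, hyy, symm y x, zero_add,
        add_zero] at hzz
      rwa [two_smul]
    refine hxy (eq_zero_of_coprime_smul (a := 2) (b := p) ?_ h2 ?_)
    · exact Int.isCoprime_two_left.2 (by exact_mod_cast hp.odd_of_ne_two hne)
    · rw [natCast_zsmul, ← mul_smul, ← pow_succ', htor x y hx]
  subst hp2
  obtain ⟨u, -, hu⟩ := exists_eq_frac hn (htor x y hx)
  have hcop : IsCoprime (u : ℤ) ((2 ^ (k + 1) : ℕ) : ℤ) :=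
    isCoprime_of_smul_frac_ne_zero Nat.prime_two (by rwa [← hu])
  obtain ⟨v, w, hvw⟩ := hcop
  have hy' : 2 ^ (k + 1) • (v • y) = 0 := by rw [smul_comm, hy, smul_zero]
  obtain ⟨a, ha, hax⟩ := exists_eq_frac hn (htor x x hx)
  obtain ⟨d, hd, hdy⟩ := exists_eq_frac hn (htor (v • y) (v • y) hy')
  refine ⟨_, _, isBlock_of_plane symm (a := ⟨a, ha⟩) (d := ⟨d, hd⟩) hx hy' hax ?_ hdy ?_⟩
  · rw [map_zsmul, hu, zsmul_frac]
    refine frac_eq_of_modEq hn (Int.modEq_iff_dvd.2 ⟨w, ?_⟩)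
    rw [← hvw]
    ring
  · exact even_of_smul_frac_eq_zero (by rw [← hax, hxx])

/-- `A` is the orthogonal sum of blocks, with the multiset `m` of types. -/
def HasBlocks (ℓ : A →ₗ[ℤ] A →ₗ[ℤ] QZ) (m : Multiset BlockType) : Prop :=
  ∃ g : m → Fin 2 → A, (∀ x, ∃ v : m → Fin 2 → ℤ, ∑ i, ∑ a, v i a • g i a = x) ∧
    (∀ i a b, ℓ (g i a) (g i b) = blockGram i.1 a b) ∧
    ∀ i j, i ≠ j → ∀ a b, ℓ (g i a) (g j b) = 0

theorem isometric_of_hasBlocks {B : Type*} [AddCommGroup B] {ℓ : A →ₗ[ℤ] A →ₗ[ℤ] QZ}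
    {ℓ' : B →ₗ[ℤ] B →ₗ[ℤ] QZ} (hℓ : ∀ x, (∀ y, ℓ x y = 0) → x = 0)
    (hℓ' : ∀ x, (∀ y, ℓ' x y = 0) → x = 0) {m : Multiset BlockType} (h : HasBlocks ℓ m)
    (h' : HasBlocks ℓ' m) : Isometric ℓ ℓ' := by
  obtain ⟨g, hg, hgi, hgj⟩ := h
  obtain ⟨g', hg', hgi', hgj'⟩ := h'
  refine isometric_of_gram (ι := m × Fin 2) hℓ hℓ' (g := fun t => g t.1 t.2)
    (g' := fun t => g' t.1 t.2) (fun x => ?_) (fun x => ?_) ?_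
  · obtain ⟨v, hv⟩ := hg x
    exact ⟨fun t => v t.1 t.2, by rw [Fintype.sum_prod_type]; exact hv⟩
  · obtain ⟨v, hv⟩ := hg' x
    exact ⟨fun t => v t.1 t.2, by rw [Fintype.sum_prod_type]; exact hv⟩
  · rintro ⟨i, a⟩ ⟨j, b⟩
    by_cases hij : i = j
    · subst hij
      exact (hgi i a b).trans (hgi' i a b).symm
    · exact (hgj i j hij a b).trans (hgj' i j hij a b).symm

/-- Blocks are split off by induction on the order of the group. -/
theorem exists_hasBlocks [Finite A] {ℓ : A →ₗ[ℤ] A →ₗ[ℤ] QZ}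
    (symm : ∀ x y, ℓ x y = ℓ y x) (hℓ : ∀ x, (∀ y, ℓ x y = 0) → x = 0) :
    ∃ m, HasBlocks ℓ m ∧ (m.map blockSize).prod ≤ Nat.card A := by
  induction hN : Nat.card A using Nat.strong_induction_on generalizing A with
  | _ N ih =>
    rcases subsingleton_or_nontrivial A with hA | hA
    · refine ⟨0, ⟨fun _ _ => 0, fun x => ⟨0, Subsingleton.elim _ _⟩, fun i => ?_, fun i => ?_⟩, ?_⟩
      · exact isEmptyElim i
      · exact isEmptyElim i
      · rw [← hN, Multiset.map_zero, Multiset.prod_zero]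
        exact Nat.card_pos
    · obtain ⟨t, g₀, ht⟩ := exists_block symm hℓ
      set U := Submodule.span ℤ (Set.range g₀) with hU
      have hcard := card_mul_card_orthogonal_le ht.nondegenerate
      have hUt : blockSize t ≤ Nat.card U := ht.size_le
      have hlt : Nat.card (orthogonal ℓ U) < N := by
        have h1 : 0 < Nat.card (orthogonal ℓ U) := Nat.card_pos
        have h2 := two_le_blockSize t
        nlinarith
      obtain ⟨m, ⟨g, hg, hgi, hgj⟩, hm⟩ := ih _ hlt (A := orthogonal ℓ U)
        (ℓ := ℓ.compl₁₂ (orthogonal ℓ U).subtype (orthogonal ℓ U).subtype)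
        (fun x y => symm x y)
        (fun x hx => Subtype.ext (orthogonal_nondegenerate hℓ ht.nondegenerate x.2
          fun y hy => hx ⟨y, hy⟩)) rfl
      refine ⟨t ::ₘ m, ⟨fun i a => (Multiset.consEquiv i).elim (g₀ a) fun j => (g j a : A),
        fun x => ?_, ?_, ?_⟩, ?_⟩
      · obtain ⟨y, hy, hxy⟩ := exists_sub_mem_orthogonal ht.nondegenerate x
        obtain ⟨v₀, hv₀⟩ := (Submodule.mem_span_range_iff_exists_fun ℤ).1 hy
        obtain ⟨v, hv⟩ := hg ⟨x - y, hxy⟩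
        refine ⟨fun i a => (Multiset.consEquiv i).elim (v₀ a) fun j => v j a, ?_⟩
        rw [Fintype.sum_equiv Multiset.consEquiv _ (fun o : Option m => ∑ a,
          (o.elim (v₀ a) fun j => v j a) • o.elim (g₀ a) fun j => (g j a : A)) fun i => rfl,
          Fintype.sum_option]
        have hv' := congrArg Subtype.val hv
        simp only [Submodule.coe_sum, Submodule.coe_smul] at hv'
        simp only [Option.elim_none, Option.elim_some]
        rw [hv₀, hv']
        abel
      · intro i a b
        obtain ⟨o, rfl⟩ := Multiset.consEquiv.symm.surjective i
        simp only [Equiv.apply_symm_apply]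
        cases o with
        | none => exact ht.gram a b
        | some j => exact hgi j a b
      · intro i j hij a b
        obtain ⟨o, rfl⟩ := Multiset.consEquiv.symm.surjective i
        obtain ⟨o', rfl⟩ := Multiset.consEquiv.symm.surjective j
        simp only [Equiv.apply_symm_apply]
        have hmem : ∀ a, g₀ a ∈ U := fun a => Submodule.subset_span ⟨a, rfl⟩
        cases o with
        | none =>
          cases o' with
          | none => exact absurd rfl hij
          | some j =>
            change ℓ (g₀ a) (g j b) = 0
            rw [symm]
            exact (g j b).2 _ (hmem a)
        | some i =>
          cases o' with
          | none => exact (g i a).2 _ (hmem b)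
          | some j => exact hgj i j (fun h => hij (by rw [h])) a b
      · rw [Multiset.map_cons, Multiset.prod_cons, ← hN]
        exact (Nat.mul_le_mul hUt hm).trans hcard

end Blocks

/-! ### Convergence of the series `Ξ` -/

/-- The weight `|block|^{-σ}`. -/
def blockWeight (σ : ℝ) (t : BlockType) : ℝ := (blockSize t : ℝ) ^ (-σ)

theorem blockWeight_nonneg (σ : ℝ) (t : BlockType) : 0 ≤ blockWeight σ t :=
  Real.rpow_nonneg (Nat.cast_nonneg _) _

theorem blockWeight_le_half {σ : ℝ} (hσ : 1 < σ) (t : BlockType) : blockWeight σ t ≤ 1 / 2 := by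
  have h2 : (2 : ℝ) ≤ blockSize t := by exact_mod_cast two_le_blockSize t
  calc blockWeight σ t ≤ (2 : ℝ) ^ (-σ) :=
        Real.rpow_le_rpow_of_nonpos (by norm_num) h2 (by linarith)
    _ ≤ (2 : ℝ) ^ (-1 : ℝ) := Real.rpow_le_rpow_of_exponent_le (by norm_num) (by linarith)
    _ = 1 / 2 := by rw [Real.rpow_neg_one]; norm_num

theorem summable_blockWeight {σ : ℝ} (hσ : 1 < σ) : Summable (blockWeight σ) := by
  -- The `2^k` blocks of order `2^k` contribute `r ^ k`, and the `4^k` blocks of order `4^k`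
  -- contribute `r ^ (2 * k)`.
  set r : ℝ := (2 : ℝ) ^ (1 - σ) with hr
  have hr0 : 0 ≤ r := by positivity
  have hr1 : r < 1 := Real.rpow_lt_one_of_one_lt_of_neg (by norm_num) (by linarith)
  have hpow : ∀ k : ℕ, ((2 ^ (k + 1) : ℕ) : ℝ) * ((2 ^ (k + 1) : ℕ) : ℝ) ^ (-σ) = r ^ (k + 1) := by
    intro k
    have hN : (0 : ℝ) < ((2 ^ (k + 1) : ℕ) : ℝ) := by positivity
    rw [← Real.rpow_one_add' hN.le (by linarith), ← sub_eq_add_neg, hr, ← Real.rpow_natCast,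
      ← Real.rpow_mul (by norm_num), Nat.cast_pow, ← Real.rpow_natCast, ← Real.rpow_mul (by norm_num),
      mul_comm]
    norm_num
  refine Summable.sum _ ?_ (Summable.sum _ ?_ ?_)
  · have h1 : Summable fun n : ℕ => ((n + 2 : ℕ) : ℝ) ^ (-σ) :=
      (summable_nat_add_iff 2).2 (Real.summable_nat_rpow.2 (by linarith))
    refine (summable_prod_of_nonneg fun t => blockWeight_nonneg σ _).2
      ⟨fun n => Summable.of_finite, ?_⟩
    refine (h1.mul_left 2).congr fun n => ?_
    rw [tsum_fintype, Fintype.sum_bool]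
    simp only [blockWeight, blockSize]
    ring
  · refine (summable_sigma_of_nonneg fun t => blockWeight_nonneg σ _).2
      ⟨fun n => Summable.of_finite, ?_⟩
    have h1 : Summable fun k : ℕ => r ^ (k + 1) :=
      (summable_nat_add_iff 1).2 (summable_geometric_of_lt_one hr0 hr1)
    refine h1.congr fun k => ?_
    rw [tsum_fintype]
    simp only [blockWeight, blockSize, Finset.sum_const, Finset.card_univ,
      Fintype.card_fin, nsmul_eq_mul]
    exact (hpow k).symm
  · refine (summable_sigma_of_nonneg fun t => blockWeight_nonneg σ _).2
      ⟨fun n => Summable.of_finite, ?_⟩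
    have h1 : Summable fun k : ℕ => (r ^ 2) ^ (k + 1) :=
      (summable_nat_add_iff 1).2 (summable_geometric_of_lt_one (by positivity)
        (pow_lt_one₀ hr0 hr1 (by norm_num)))
    refine h1.congr fun k => ?_
    rw [tsum_fintype]
    simp only [blockWeight, blockSize, Finset.sum_const, Finset.card_univ,
      Fintype.card_fin, Fintype.card_prod, nsmul_eq_mul]
    have hN : (0 : ℝ) ≤ ((2 ^ (k + 1) : ℕ) : ℝ) := by positivity
    rw [← pow_mul, mul_comm 2, pow_mul, ← hpow k, Nat.cast_pow _ 2, Nat.cast_mul, sq, sq,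
      Real.mul_rpow hN hN]
    ring

/-- Sums over multisets: the Euler product `∏ (1 - w t)⁻¹` converges. -/
theorem summable_multiset {τ : Type*} [DecidableEq τ] {w : τ → ℝ} (h0 : ∀ t, 0 ≤ w t)
    (h1 : ∀ t, w t ≤ 1 / 2) (hw : Summable w) :
    Summable fun m : Multiset τ => (m.map w).prod := by
  -- The family of all positive powers `w t ^ (n + 1)` is summable, and a multiset is determined by
  -- the finite set of the pairs of an element and its multiplicity.
  set F : τ × ℕ → ℝ := fun x => w x.1 ^ (x.2 + 1) with hF
  have hF0 : ∀ x, 0 ≤ F x := fun x => pow_nonneg (h0 _) _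
  have hgeo : ∀ t, HasSum (fun n : ℕ => F (t, n)) (w t * (1 - w t)⁻¹) := by
    intro t
    have := (hasSum_geometric_of_lt_one (h0 t) (by linarith [h1 t])).mul_left (w t)
    simpa only [hF, pow_succ'] using this
  have hFs : Summable F := by
    refine (summable_prod_of_nonneg hF0).2 ⟨fun t => (hgeo t).summable, ?_⟩
    simp only [(hgeo _).tsum_eq]
    refine Summable.of_nonneg_of_le
      (fun t => mul_nonneg (h0 t) (inv_nonneg.2 (by linarith [h1 t]))) (fun t => ?_)
      (hw.mul_right 2)
    refine mul_le_mul_of_nonneg_left ?_ (h0 t)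
    rw [inv_le_comm₀ (by linarith [h1 t]) (by norm_num)]
    linarith [h1 t]
  have hinj : Function.Injective (fun m : Multiset τ =>
      m.toFinset.image fun t => (t, m.count t - 1)) := by
    have hmem : ∀ (m : Multiset τ) (t : τ) (n : ℕ),
        (t, n) ∈ m.toFinset.image (fun t => (t, m.count t - 1)) ↔ m.count t = n + 1 := by
      intro m t n
      simp only [Finset.mem_image, Multiset.mem_toFinset, Prod.mk.injEq]
      constructor
      · rintro ⟨t', ht', rfl, rfl⟩
        have := Multiset.count_pos.2 ht'
        omega
      · intro h
        exact ⟨t, Multiset.count_pos.1 (by omega), rfl, by omega⟩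
    intro m m' h
    ext t
    have h2 : ∀ n, m.count t = n + 1 ↔ m'.count t = n + 1 := fun n => by
      rw [← hmem, ← hmem]
      simp only at h
      rw [h]
    rcases hm : m.count t with _ | n
    · rcases hm' : m'.count t with _ | n
      · rfl
      · have := (h2 n).2 hm'
        omega
    · exact ((h2 n).1 hm).symm
  refine ((summable_finsetProd_of_summable_nonneg hF0 hFs).comp_injective hinj).congr fun m => ?_
  rw [Finset.prod_multiset_map_count]
  simp only [Function.comp]
  rw [Finset.prod_image fun t _ t' _ h => congrArg Prod.fst h]
  refine Finset.prod_congr rfl fun t ht => ?_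
  have := Multiset.count_pos.2 (Multiset.mem_toFinset.1 ht)
  rw [hF]
  simp only
  rw [Nat.sub_add_cancel this]

/-- The classes of pairs `(A, ℓ)` with `A` finite. -/
abbrev FiniteClass : Type 1 :=
  {P : PairClass // ∃ X : LinkingPair, (⟦X⟧ : PairClass) = P ∧ Finite X}

/-- The order of a class of finite pairs. -/
def FiniteClass.order (P : FiniteClass) : ℕ := Nat.card P.2.choose

theorem card_eq_of_equivalent {X Y : LinkingPair} (h : X.Equivalent Y) : Nat.card X = Nat.card Y :=
  Nat.card_congr h.choose.toEquiv

theorem FiniteClass.finite_choose (P : FiniteClass) : Finite P.2.choose := P.2.choose_spec.2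

theorem FiniteClass.order_eq (P : FiniteClass) {X : LinkingPair} (h : (⟦X⟧ : PairClass) = P.1) :
    P.order = Nat.card X :=
  card_eq_of_equivalent (Quotient.exact (P.2.choose_spec.1.trans h.symm))

theorem FiniteClass.order_pos (P : FiniteClass) : 0 < P.order := by
  have := P.finite_choose
  exact Nat.card_pos

theorem LinkingPair.rank_eq_zero (X : LinkingPair) [Finite X] : X.rank = 0 := by
  rw [rank, Module.finrank, Module.rank_eq_zero_iff_isTorsion.2, map_zero]
  intro x
  exact (Submodule.mem_torsion_iff _).1 (mem_torsion_of_finite x)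

theorem LinkingPair.card_tor (X : LinkingPair) [Finite X] : Nat.card X.Tor = Nat.card X :=
  Nat.card_congr (Equiv.subtypeUnivEquiv fun x => mem_torsion_of_finite x)

/-- Finite classes inject into the multisets of blocks, so that the sum is dominated by an Euler
product. -/
theorem summable_finiteClass {σ : ℝ} (hσ : 1 < σ) :
    Summable fun P : FiniteClass => (P.order : ℝ) ^ (-σ) := by
  have hex : ∀ P : FiniteClass, ∃ m, HasBlocks P.2.choose.form m ∧
      (m.map blockSize).prod ≤ Nat.card P.2.choose.Tor := fun P =>
    exists_hasBlocks P.2.choose.symm P.2.choose.nondegenerate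
  choose m hm hmcard using hex
  have hinj : Function.Injective m := by
    intro P Q h
    have hP := P.finite_choose
    have hQ := Q.finite_choose
    have hiso : Isometric P.2.choose.form Q.2.choose.form :=
      isometric_of_hasBlocks P.2.choose.nondegenerate Q.2.choose.nondegenerate (hm P)
        (by rw [h]; exact hm Q)
    have heq := LinkingPair.equivalent_of_isometric
      (by rw [LinkingPair.rank_eq_zero, LinkingPair.rank_eq_zero]) hiso
    refine Subtype.ext ?_
    rw [← P.2.choose_spec.1, ← Q.2.choose_spec.1]
    exact Quotient.sound heq
  refine Summable.of_nonneg_of_le (fun P => Real.rpow_nonneg (Nat.cast_nonneg _) _) (fun P => ?_)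
    ((summable_multiset (blockWeight_nonneg σ) (blockWeight_le_half hσ)
      (summable_blockWeight hσ)).comp_injective hinj)
  have hprod : ∀ m : Multiset BlockType,
      (m.map (blockWeight σ)).prod = (((m.map blockSize).prod : ℕ) : ℝ) ^ (-σ) := by
    intro m
    induction m using Multiset.induction_on with
    | empty => simp
    | cons t m ih =>
      rw [Multiset.map_cons, Multiset.prod_cons, ih, Multiset.map_cons, Multiset.prod_cons,
        Nat.cast_mul, Real.mul_rpow (Nat.cast_nonneg _) (Nat.cast_nonneg _), blockWeight]
  have hP := P.finite_choose
  rw [Function.comp_apply, hprod]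
  refine Real.rpow_le_rpow_of_nonpos ?_ ?_ (by linarith)
  · have : 0 < ((m P).map blockSize).prod := by
      refine Nat.pos_of_ne_zero (Multiset.prod_ne_zero fun h => ?_)
      obtain ⟨t, -, ht⟩ := Multiset.mem_map.1 h
      have := two_le_blockSize t
      omega
    exact_mod_cast this
  · have := hmcard P
    rw [LinkingPair.card_tor] at this
    exact_mod_cast this

/-- The series `Ξ` groups the finite classes according to their orders; convergence shows that
there are finitely many of each order, so that `a(n)` really counts them. -/
theorem hasSum_XiTerm {σ : ℝ} (hσ : 1 < σ) :
    HasSum (XiTerm σ) (∑' P : FiniteClass, (P.order : ℝ) ^ (-σ)) := by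
  have hs := summable_finiteClass hσ
  set o : FiniteClass → ℕ+ := fun P => ⟨P.order, P.order_pos⟩ with ho
  have h1 := (Equiv.sigmaFiberEquiv o).hasSum_iff.2 hs.hasSum
  have hfib : ∀ n : ℕ+, HasSum (fun P : {P // o P = n} => ((P.1.order : ℕ) : ℝ) ^ (-σ))
      (XiTerm σ n) := by
    intro n
    have hterm : ∀ P : {P // o P = n}, ((P.1.order : ℕ) : ℝ) ^ (-σ) = ((n : ℕ) : ℝ) ^ (-σ) := by
      rintro ⟨P, rfl⟩
      rfl
    have hsum := hs.comp_injective (Subtype.val_injective (p := fun P => o P = n))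
    have hpos : (0 : ℝ) < ((n : ℕ) : ℝ) ^ (-σ) := Real.rpow_pos_of_pos (by exact_mod_cast n.pos) _
    have hfin : Finite {P // o P = n} := by
      have h2 : Summable fun _ : {P // o P = n} => ((n : ℕ) : ℝ) ^ (-σ) := hsum.congr hterm
      by_contra hinf
      have := not_finite_iff_infinite.1 hinf
      exact hpos.ne' ((summable_const_iff _).1 h2)
    cases nonempty_fintype {P // o P = n}
    have h3 := hasSum_fintype (fun P : {P // o P = n} => ((P.1.order : ℕ) : ℝ) ^ (-σ))
    convert h3 using 1
    simp only [hterm, Finset.sum_const, Finset.card_univ, nsmul_eq_mul, XiTerm, formCount]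
    congr 2
    rw [← Nat.card_eq_fintype_card]
    refine Nat.card_congr ⟨fun P => ⟨⟨P.1, ?_⟩, ?_⟩, fun P => ⟨P.1.1, ?_⟩, fun P => rfl, fun P => rfl⟩
    · obtain ⟨X, hX, hX', -⟩ := P.2
      exact ⟨X, hX, hX'⟩
    · obtain ⟨X, hX, hX', hX''⟩ := P.2
      refine PNat.eq ?_
      exact (FiniteClass.order_eq _ hX).trans hX''
    · have hP := P.2
      refine ⟨P.1.2.choose, P.1.2.choose_spec.1, P.1.2.choose_spec.2, ?_⟩
      exact congrArg PNat.val hP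
  exact h1.sigma hfib

/-! ### Product weights -/

theorem hasSum_pi_pow {X : Type*} {h : X → ℝ} {N : ℝ} (h0 : ∀ x, 0 ≤ h x) (hN : HasSum h N)
    (g : ℕ) : HasSum (fun f : Fin g → X => ∏ i, h (f i)) (N ^ g) := by
  induction g with
  | zero => simp
  | succ g ih =>
    have hs : Summable fun t : X × (Fin g → X) => h t.1 * ∏ i, h (t.2 i) :=
      Summable.mul_of_nonneg (f := h) (g := fun f : Fin g → X => ∏ i, h (f i)) hN.summable
        ih.summable (fun x => h0 x) fun f => Finset.prod_nonneg fun i _ => h0 _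
    have h1 := hN.mul ih hs
    rw [pow_succ']
    refine (Fin.consEquiv fun _ : Fin (g + 1) => X).hasSum_iff.1 ?_
    convert! h1 using 1
    funext t
    simp only [Function.comp, Fin.prod_univ_succ]
    rfl

/-- The number `N = |𝔏| ν(ker α)` is a multiple of `|𝔏|` bounded independently of `α`, and is
written as a sum over the whole of `A`. The integrality of `ν` on singletons makes `ν` nonnegative. -/
theorem exists_kernel_weight {D : Type*} [AddCommGroup D] (Lag : AddSubgroup D) {X : LinkingPair}
    {ν : X → ℝ} (hν : ∀ S : Set X, ∃ k : ℕ, HasSum (fun φ : S => ν φ) (k : ℝ)) :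
    (∀ φ, 0 ≤ ν φ) ∧ ∃ K : ℝ, HasSum ν K ∧ ∀ α : X →ₗ[ℤ] (Lag →ₗ[ℤ] QZ), ∃ N : ℕ,
      (∑' φ : LinearMap.ker α, ν φ) * (Nat.card Lag : ℝ) = N ∧ Nat.card Lag ∣ N ∧
      HasSum (Set.indicator {φ | α φ = 0} fun φ => ν φ * (Nat.card Lag : ℝ)) N ∧
      (N : ℝ) ≤ K * Nat.card Lag := by
  have h0 : ∀ φ, 0 ≤ ν φ := by
    intro φ
    obtain ⟨k, hk⟩ := hν {φ}
    have : ν φ = k := (hasSum_unique (fun ψ : ({φ} : Set X) => ν ψ)).unique hk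
    rw [this]
    exact Nat.cast_nonneg k
  obtain ⟨K, hK⟩ := hν Set.univ
  have hK' : HasSum ν K := (Equiv.Set.univ X).symm.hasSum_iff.2 hK
  refine ⟨h0, K, hK', fun α => ?_⟩
  obtain ⟨k, hk⟩ := hν {φ | α φ = 0}
  have hker : ∑' φ : LinearMap.ker α, ν φ = k := hk.tsum_eq
  have hind : HasSum (Set.indicator {φ | α φ = 0} ν) k := hasSum_subtype_iff_indicator.1 hk
  have hle : (k : ℝ) ≤ K := hasSum_le (fun φ => Set.indicator_le_self' (fun φ _ => h0 φ) φ) hind hK'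
  refine ⟨k * Nat.card Lag, ?_, Dvd.intro_left _ rfl, ?_, ?_⟩
  · rw [hker]
    push_cast
    rfl
  · push_cast
    convert! hind.mul_right (Nat.card Lag : ℝ) using 1
    ext φ
    by_cases hφ : α φ = 0 <;> simp [Set.indicator, hφ]
  · push_cast
    exact mul_le_mul_of_nonneg_right hle (Nat.cast_nonneg _)

section DirichletTermSum

variable {D : Type*} [AddCommGroup D] {q : QuadraticMap ℤ D QZ} {Lag : AddSubgroup D}
  {X : LinkingPair} [Finite D] (hq : IsNondegenerate q) (hLag : IsLagrangian q Lag)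
  [Fintype (X →ₗ[ℤ] (Lag →ₗ[ℤ] QZ))]

open Classical in
include hq hLag in
/-- Fourier inversion turns the double sum over `θ` and `α` into a sum of amplitudes. -/
theorem dirichletTerm_eq (μ₀ : ℝ) (ν : X → ℝ) (n : ℕ) :
    dirichletTerm q Lag X μ₀ ν n = ∑ α : X →ₗ[ℤ] (Lag →ₗ[ℤ] QZ),
      if (∑' φ : LinearMap.ker α, ν φ) * (Nat.card Lag : ℝ) = (n : ℝ) then
        (μ₀ : ℂ) * ((Nat.card Lag : ℂ)⁻¹ * amplitude q Lag X α) else 0 := by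
  have := finite_tensor (A := X.Tor) (E := Lag)
  have := finite_tensor (A := X) (E := Lag)
  have : Fintype (Lag ⊗[ℤ] X.Tor) := Fintype.ofFinite _
  have hT : (Nat.card (Lag ⊗[ℤ] X) : ℂ) ≠ 0 := by exact_mod_cast Nat.card_pos.ne'
  rw [dirichletTerm, finsum_eq_sum_of_fintype]
  simp only [finsum_eq_sum_of_fintype (α := X →ₗ[ℤ] (Lag →ₗ[ℤ] QZ)), finsum_eq_if]
  rw [Finset.sum_comm, Finset.mul_sum]
  refine Finset.sum_congr rfl fun α _ => ?_
  split_ifs with h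
  · rw [sum_theta_eq hq hLag]
    push_cast
    field_simp
  · simp

include hq hLag in
/-- Fourier expansion of the contribution of `(A, ℓ, f)`, for a product weight: the sum over the
labels of the `i`-th component is `|𝔏|` if `α` annihilates `f_i`, and zero otherwise. -/
theorem summand_eq {g : ℕ} (f : Fin g → X) (w : ℝ≥0) (μ₀ : ℝ) (ν : X → ℝ)
    (hw : (w : ℝ) = μ₀ * ∏ i, ν (f i)) : summand q Lag X f w =
      ∑ α : X →ₗ[ℤ] (Lag →ₗ[ℤ] QZ), (μ₀ : ℂ) * ((Nat.card Lag : ℂ)⁻¹ * amplitude q Lag X α) *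
        ((∏ i, Set.indicator {φ | α φ = 0} (fun φ => ν φ * (Nat.card Lag : ℝ)) (f i) : ℝ) : ℂ) := by
  classical
  have : Fintype Lag := Fintype.ofFinite _
  have hsum : ∀ (α : X →ₗ[ℤ] (Lag →ₗ[ℤ] QZ)) (φ : X), (ν φ : ℂ) * ∑ c : Lag, e (-α φ c)
      = ((Set.indicator {φ | α φ = 0} (fun φ => ν φ * (Nat.card Lag : ℝ)) φ : ℝ) : ℂ) := by
    intro α φ
    by_cases hφ : α φ = 0
    · simp [Set.indicator, hφ]
    · have h1 := sum_e_eq_zero (h := -α φ) (neg_ne_zero.2 hφ)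
      simp only [LinearMap.neg_apply] at h1
      simp [Set.indicator, hφ, h1]
  rw [summand, finsum_eq_sum_of_fintype, hw]
  simp only [partitionFunction_eq_sum hq hLag]
  rw [← Finset.mul_sum, Finset.sum_comm, Finset.mul_sum, Finset.mul_sum]
  refine Finset.sum_congr rfl fun α _ => ?_
  have hprod : ∑ c : Fin g → Lag, e (-∑ i, α (f i) (c i)) = ∏ i, ∑ c : Lag, e (-α (f i) c) := by
    rw [Finset.prod_univ_sum, Fintype.piFinset_univ]
    refine Finset.sum_congr rfl fun c _ => ?_
    rw [← e_sum, Finset.sum_neg_distrib]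
  rw [← Finset.mul_sum, hprod, Complex.ofReal_prod]
  simp only [← hsum]
  rw [Finset.prod_mul_distrib]
  push_cast
  ring

end DirichletTermSum

/-! ### Summation over all pairs -/

/-- A class of pairs is determined by its rank and the class of its torsion part, so the sum is
dominated by the product of a geometric series and `Ξ(σ)`. -/
theorem summable_pairClass {rep : PairClass → LinkingPair}
    (hrep : ∀ P : PairClass, (⟦rep P⟧ : PairClass) = P) {x σ : ℝ} (hx0 : 0 ≤ x) (hx1 : x < 1)
    (hσ : 1 < σ) :
    Summable (fun P => x ^ (rep P).rank * (Nat.card (rep P).Tor : ℝ) ^ (-σ)) ∧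
    ∑' P, x ^ (rep P).rank * (Nat.card (rep P).Tor : ℝ) ^ (-σ) ≤ Xi σ / (1 - x) := by
  have hfin : ∀ P, Finite (rep P).torsionPart := fun P =>
    inferInstanceAs (Finite (rep P).Tor)
  set j : PairClass → ℕ × FiniteClass := fun P =>
    ((rep P).rank, ⟨⟦(rep P).torsionPart⟧, (rep P).torsionPart, rfl, hfin P⟩) with hj
  have hinj : Function.Injective j := by
    intro P Q h
    have h1 : (rep P).rank = (rep Q).rank := congrArg Prod.fst h
    have h2 : (⟦(rep P).torsionPart⟧ : PairClass) = ⟦(rep Q).torsionPart⟧ :=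
      congrArg (fun t => t.2.1) h
    rw [← hrep P, ← hrep Q]
    exact Quotient.sound (LinkingPair.equivalent_of_isometric h1
      (LinkingPair.isometric_of_torsionPart_equivalent (Quotient.exact h2)))
  have hgeo := hasSum_geometric_of_lt_one hx0 hx1
  have hw := summable_finiteClass hσ
  have hw0 : ∀ P : FiniteClass, 0 ≤ (P.order : ℝ) ^ (-σ) := fun P =>
    Real.rpow_nonneg (Nat.cast_nonneg _) _
  have hprod : Summable fun t : ℕ × FiniteClass => x ^ t.1 * (t.2.order : ℝ) ^ (-σ) :=
    Summable.mul_of_nonneg (f := fun n : ℕ => x ^ n)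
      (g := fun P : FiniteClass => (P.order : ℝ) ^ (-σ)) hgeo.summable hw
      (fun n => pow_nonneg hx0 n) hw0
  have hcomp : ∀ P, x ^ (j P).1 * ((j P).2.order : ℝ) ^ (-σ)
      = x ^ (rep P).rank * (Nat.card (rep P).Tor : ℝ) ^ (-σ) := by
    intro P
    rw [FiniteClass.order_eq (j P).2 (X := (rep P).torsionPart) rfl]
    rfl
  refine ⟨(hprod.comp_injective hinj).congr hcomp, ?_⟩
  calc ∑' P, x ^ (rep P).rank * (Nat.card (rep P).Tor : ℝ) ^ (-σ)
      = ∑' P, x ^ (j P).1 * ((j P).2.order : ℝ) ^ (-σ) := tsum_congr fun P => (hcomp P).symm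
    _ ≤ ∑' t : ℕ × FiniteClass, x ^ t.1 * (t.2.order : ℝ) ^ (-σ) :=
        tsum_comp_le_tsum_of_inj hprod
          (fun t => mul_nonneg (pow_nonneg hx0 _) (hw0 _)) hinj
    _ = (∑' n : ℕ, x ^ n) * ∑' P : FiniteClass, (P.order : ℝ) ^ (-σ) :=
        (hgeo.summable.tsum_mul_tsum hw hprod).symm
    _ = Xi σ / (1 - x) := by
        rw [hgeo.tsum_eq, Xi, (hasSum_XiTerm hσ).tsum_eq, div_eq_inv_mul]

section Local

variable {D : Type*} [AddCommGroup D] {q : QuadraticMap ℤ D QZ} {Lag : AddSubgroup D}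
  {X : LinkingPair} [Finite D] (hq : IsNondegenerate q) (hLag : IsLagrangian q Lag) {g : ℕ}
  {μ : (Fin g → X) → ℝ≥0} {M : ℝ}

include hq hLag in
theorem norm_summand_le (f : Fin g → X) (w : ℝ≥0) : ‖summand q Lag X f w‖ ≤
    w * ((Nat.card Lag : ℝ) ^ g * (Nat.card Lag : ℝ)⁻¹ *
      Nat.card (X →ₗ[ℤ] (Lag →ₗ[ℤ] QZ))) := by
  have := finite_linearMap (A := X) (E := Lag →ₗ[ℤ] QZ)
  have : Fintype (X →ₗ[ℤ] (Lag →ₗ[ℤ] QZ)) := Fintype.ofFinite _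
  have : Fintype Lag := Fintype.ofFinite _
  rw [summand, norm_mul, finsum_eq_sum_of_fintype, Complex.norm_real, Real.norm_eq_abs,
    abs_of_nonneg w.coe_nonneg, mul_assoc]
  refine mul_le_mul_of_nonneg_left ?_ w.coe_nonneg
  refine (norm_sum_le_of_le _ fun c _ => norm_partitionFunction_le hq hLag f c).trans_eq ?_
  rw [Finset.sum_const, Finset.card_univ, Fintype.card_fun, Fintype.card_fin, nsmul_eq_mul,
    ← Nat.card_eq_fintype_card]
  push_cast
  ring

include hq hLag in
/-- The contribution of one pair `(A, ℓ)` to `𝒵_g` as a finite Dirichlet polynomial, with a bound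
that is uniform in the weights. -/
theorem hasSum_dirichletTerm (hμ : HasSum (fun f => (μ f : ℝ)) M) {μ₀ : ℝ} {ν : X → ℝ}
    (hfac : ∀ f : Fin g → X, (μ f : ℝ) = μ₀ * ∏ i, ν (f i))
    (hν : ∀ S : Set X, ∃ k : ℕ, HasSum (fun φ : S => ν φ) (k : ℝ)) :
    HasSum (fun n : ℕ => dirichletTerm q Lag X μ₀ ν n * (n : ℂ) ^ g)
      (∑' f, summand q Lag X f (μ f)) ∧
    Summable (fun n : ℕ => ‖dirichletTerm q Lag X μ₀ ν n * (n : ℂ) ^ g‖) ∧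
    ∑' n : ℕ, ‖dirichletTerm q Lag X μ₀ ν n * (n : ℂ) ^ g‖ ≤
      M * ((Nat.card Lag : ℝ) ^ g * (Nat.card Lag : ℝ)⁻¹ *
        Nat.card (X →ₗ[ℤ] (Lag →ₗ[ℤ] QZ))) := by
  classical
  have := finite_linearMap (A := X) (E := Lag →ₗ[ℤ] QZ)
  have : Fintype (X →ₗ[ℤ] (Lag →ₗ[ℤ] QZ)) := Fintype.ofFinite _
  obtain ⟨hν0, K, hK, hker⟩ := exists_kernel_weight Lag hν
  choose N hN _ hNsum hNle using hker
  set T : (X →ₗ[ℤ] (Lag →ₗ[ℤ] QZ)) → ℂ := fun α =>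
    (μ₀ : ℂ) * ((Nat.card Lag : ℂ)⁻¹ * amplitude q Lag X α) with hT
  have hterm : ∀ n : ℕ, dirichletTerm q Lag X μ₀ ν n * (n : ℂ) ^ g
      = ∑ α, if n = N α then T α * (N α : ℂ) ^ g else 0 := by
    intro n
    rw [dirichletTerm_eq hq hLag, Finset.sum_mul]
    refine Finset.sum_congr rfl fun α _ => ?_
    rw [hN]
    by_cases h : n = N α
    · simp [h, hT]
    · have h' : ¬ ((N α : ℝ) = n) := fun h' => h (by exact_mod_cast h'.symm)
      simp [h, h']
  have hsum : HasSum (fun n : ℕ => dirichletTerm q Lag X μ₀ ν n * (n : ℂ) ^ g)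
      (∑ α, T α * (N α : ℂ) ^ g) := by
    simp only [hterm]
    exact hasSum_sum fun α _ => hasSum_ite_eq (N α) (T α * (N α : ℂ) ^ g)
  have hsummand : HasSum (fun f : Fin g → X => summand q Lag X f (μ f))
      (∑ α, T α * (N α : ℂ) ^ g) := by
    simp only [fun f => summand_eq hq hLag f (μ f) μ₀ ν (hfac f)]
    refine hasSum_sum fun α _ => ?_
    have h1 := hasSum_pi_pow (fun φ => Set.indicator_nonneg
      (fun φ _ => mul_nonneg (hν0 φ) (Nat.cast_nonneg _)) φ) (hNsum α) g
    have h2 := (Complex.hasSum_ofReal.2 h1).mul_left (T α)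
    simpa only [Complex.ofReal_pow, Complex.ofReal_natCast] using h2
  -- The sign of `μ₀` is immaterial, since the products `μ₀ ∏ ν (f i)` are nonnegative.
  have hM : |μ₀| * K ^ g = M := by
    refine ((hasSum_pi_pow hν0 hK g).mul_left |μ₀|).unique ?_
    convert! hμ using 1
    funext f
    rw [← abs_of_nonneg (μ f).coe_nonneg, hfac, abs_mul,
      abs_of_nonneg (Finset.prod_nonneg fun i _ => hν0 (f i))]
  have hbound : ∀ α, ‖T α * (N α : ℂ) ^ g‖ ≤
      M * ((Nat.card Lag : ℝ) ^ g * (Nat.card Lag : ℝ)⁻¹) := by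
    intro α
    have h1 : (N α : ℝ) ^ g ≤ (K * Nat.card Lag) ^ g :=
      pow_le_pow_left₀ (Nat.cast_nonneg _) (hNle α) g
    calc ‖T α * (N α : ℂ) ^ g‖
        = |μ₀| * ((Nat.card Lag : ℝ)⁻¹ * ‖amplitude q Lag X α‖) * (N α : ℝ) ^ g := by
          simp [hT]
      _ ≤ |μ₀| * ((Nat.card Lag : ℝ)⁻¹ * 1) * (K * Nat.card Lag) ^ g := by
          gcongr
          · exact norm_amplitude_le q Lag X α
      _ = M * ((Nat.card Lag : ℝ) ^ g * (Nat.card Lag : ℝ)⁻¹) := by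
          rw [← hM, mul_pow]
          ring
  have hnorm : HasSum (fun n : ℕ => ∑ α, if n = N α then ‖T α * (N α : ℂ) ^ g‖ else 0)
      (∑ α, ‖T α * (N α : ℂ) ^ g‖) :=
    hasSum_sum fun α _ => hasSum_ite_eq (N α) ‖T α * (N α : ℂ) ^ g‖
  have hle : ∀ n : ℕ, ‖dirichletTerm q Lag X μ₀ ν n * (n : ℂ) ^ g‖ ≤
      ∑ α, if n = N α then ‖T α * (N α : ℂ) ^ g‖ else 0 := by
    intro n
    rw [hterm]
    refine norm_sum_le_of_le _ fun α _ => ?_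
    split_ifs <;> simp
  have hs := hnorm.summable.of_nonneg_of_le (fun n => norm_nonneg _) hle
  refine ⟨hsummand.tsum_eq ▸ hsum, hs, ?_⟩
  refine (hs.tsum_le_tsum hle hnorm.summable).trans ?_
  rw [hnorm.tsum_eq]
  refine (Finset.sum_le_sum fun α _ => hbound α).trans_eq ?_
  rw [Finset.sum_const, Finset.card_univ, nsmul_eq_mul, ← Nat.card_eq_fintype_card]
  ring

end Local

section Global

variable {D : Type*} [AddCommGroup D] {q : QuadraticMap ℤ D QZ} {Lag : AddSubgroup D} [Finite D]
  (hq : IsNondegenerate q) (hLag : IsLagrangian q Lag) {g : ℕ} {C lam s : ℝ}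

include hq hLag in
/-- The order of `D` is the square of that of `𝔏`, which clears all the square roots of `|D|`. -/
theorem rpow_card_half (t : ℝ) : (Nat.card D : ℝ) ^ (t / 2) = (Nat.card Lag : ℝ) ^ t := by
  rw [(pairing_surjective_and_card hq hLag).2, Nat.cast_pow, ← Real.rpow_natCast,
    ← Real.rpow_mul (Nat.cast_nonneg _)]
  congr 1
  push_cast
  ring

/-- The bound for the weights, multiplied by the number of labels and of homomorphisms, in terms
of the rank and the order of the torsion subgroup. -/
theorem weight_mul_card_hom_le (X : LinkingPair) (hC : 0 < C) (hlam₀ : 0 ≤ lam) {K : ℝ}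
    (hK : 0 ≤ K) :
    C * lam ^ X.rank * (Nat.card X.Tor : ℝ) ^ (-s) *
        (K * Nat.card (X →ₗ[ℤ] (Lag →ₗ[ℤ] QZ))) ≤
      C * K * ((lam * Nat.card Lag) ^ X.rank *
        (Nat.card X.Tor : ℝ) ^ (-(s - AddGroup.rank D))) := by
  have hT : (0 : ℝ) < Nat.card X.Tor := by exact_mod_cast Nat.card_pos
  have h1 : (Nat.card (X →ₗ[ℤ] (Lag →ₗ[ℤ] QZ)) : ℝ) ≤
      (Nat.card Lag : ℝ) ^ X.rank * (Nat.card X.Tor : ℝ) ^ AddGroup.rank D := by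
    exact_mod_cast card_hom_le Lag X
  have h2 : (Nat.card X.Tor : ℝ) ^ (-(s - AddGroup.rank D))
      = (Nat.card X.Tor : ℝ) ^ (-s) * (Nat.card X.Tor : ℝ) ^ AddGroup.rank D := by
    rw [← Real.rpow_natCast, ← Real.rpow_add hT]
    congr 1
    ring
  have h3 : 0 ≤ (Nat.card X.Tor : ℝ) ^ (-s) := Real.rpow_nonneg hT.le _
  calc _ ≤ C * lam ^ X.rank * (Nat.card X.Tor : ℝ) ^ (-s) *
        (K * ((Nat.card Lag : ℝ) ^ X.rank * (Nat.card X.Tor : ℝ) ^ AddGroup.rank D)) := by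
        gcongr
    _ = _ := by
        rw [h2, mul_pow]
        ring

end Global

theorem exists_hasSum_of_tsum_le {ι : Type*} {w : ι → ℝ≥0} {B : ℝ} (hB : 0 ≤ B)
    (h : ∑' i, (w i : ℝ≥0∞) ≤ ENNReal.ofReal B) :
    ∃ M : ℝ, HasSum (fun i => (w i : ℝ)) M ∧ M ≤ B := by
  have hs : Summable w := ENNReal.tsum_coe_ne_top_iff_summable.1
    (ne_top_of_le_ne_top ENNReal.ofReal_ne_top h)
  refine ⟨_, NNReal.hasSum_coe.2 hs.hasSum, ?_⟩
  rw [← ENNReal.coe_tsum hs, ENNReal.ofReal, ENNReal.coe_le_coe] at h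
  exact (Real.le_toNNReal_iff_coe_le hB).1 h

theorem summable_prod_of_row_bound {ι : Type*} {F : ι → ℕ → ℂ} {B : ι → ℝ} (hB : Summable B)
    (hF : ∀ i, Summable fun n => ‖F i n‖) (hle : ∀ i, ∑' n, ‖F i n‖ ≤ B i) :
    Summable fun t : ι × ℕ => F t.1 t.2 := by
  refine Summable.of_norm ((summable_prod_of_nonneg fun t => norm_nonneg _).2 ⟨hF, ?_⟩)
  exact hB.of_nonneg_of_le (fun i => tsum_nonneg fun n => norm_nonneg _) hle

end AbelianTQFT

end

open AbelianTQFT in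
theorem mainTheorem3 {D : Type*} [AddCommGroup D] [Finite D]
    (q : QuadraticMap ℤ D QZ) (hq : IsNondegenerate q)
    (Lag : AddSubgroup D) (hLag : IsLagrangian q Lag)
    (g : ℕ)
    (rep : PairClass → LinkingPair) (hrep : ∀ P : PairClass, (⟦rep P⟧ : PairClass) = P)
    (μ : (P : PairClass) → (Fin g → rep P) → ℝ≥0)
    (C lam s : ℝ) (hC : 0 < C) (hlam₀ : 0 ≤ lam)
    (hμ : ∀ P : PairClass, ∑' f : Fin g → rep P, (μ P f : ℝ≥0∞) ≤
      ENNReal.ofReal (C * lam ^ (rep P).rank * (Nat.card (rep P).Tor : ℝ) ^ (-s)))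
    (hlam : lam < (Nat.card D : ℝ) ^ (-(1 / 2) : ℝ))
    (hs : (AddGroup.rank D : ℝ) + 1 < s) :
    -- the partition function does not depend on the surgery presentation, and depends on the
    -- homology classes and the labels only through `θ`
    (∀ (X : LinkingPair) (k : ℕ) (f : Fin k → X) (c : Fin k → Lag),
      (∀ S : SurgeryPresentation X f,
        S.value q (fun i => (c i : D)) = partitionFunction q Lag X f c) ∧
      partitionFunction q Lag X f c =
        thetaPartitionFunction q Lag X (∑ i, c i ⊗ₜ[ℤ] f i)) ∧
    -- absolute convergence and the bound
    Summable (XiTerm (s - AddGroup.rank D)) ∧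
    Summable (fun t : (P : PairClass) × (Fin g → rep P) =>
      summand q Lag (rep t.1) t.2 (μ t.1 t.2)) ∧
    ‖connectedZ q Lag g rep μ‖ ≤
      C * (Nat.card D : ℝ) ^ (((g : ℝ) - 1) / 2) * Xi (s - AddGroup.rank D) /
        (1 - lam * (Nat.card D : ℝ) ^ (1 / 2 : ℝ)) ∧
    -- the Dirichlet series
    ∀ (μ₀ : PairClass → ℝ) (ν : (P : PairClass) → rep P → ℝ),
      (∀ (P : PairClass) (f : Fin g → rep P), (μ P f : ℝ) = μ₀ P * ∏ i, ν P (f i)) →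
      (∀ (P : PairClass) (S : Set (rep P)), ∃ k : ℕ, HasSum (fun φ : S => ν P φ) (k : ℝ)) →
      (∀ n : ℕ, 1 ≤ n →
        Summable (fun P : PairClass => dirichletTerm q Lag (rep P) (μ₀ P) (ν P) n)) ∧
      (∀ n : ℕ, ¬ Nat.card Lag ∣ n → dirichletCoeff q Lag rep μ₀ ν n = 0) ∧
      HasSum (fun n : ℕ => dirichletCoeff q Lag rep μ₀ ν n * (n : ℂ) ^ g)
        (connectedZ q Lag g rep μ) ∧
      ((1 ≤ g ∨ ∀ (P : PairClass) (α : rep P →ₗ[ℤ] (Lag →ₗ[ℤ] QZ)),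
          ∑' φ : LinearMap.ker α, ν P φ ≠ 0) →
        HasSum (fun n : ℕ+ => dirichletCoeff q Lag rep μ₀ ν n * ((n : ℕ) : ℂ) ^ g)
          (connectedZ q Lag g rep μ)) := by
  have hfin : ∀ X : LinkingPair, Finite (X →ₗ[ℤ] (Lag →ₗ[ℤ] QZ)) := fun X => finite_linearMap
  let (X : LinkingPair) : Fintype (X →ₗ[ℤ] (Lag →ₗ[ℤ] QZ)) := Fintype.ofFinite _
  have hL : (0 : ℝ) < Nat.card Lag := by exact_mod_cast Nat.card_pos
  have hσ : 1 < s - AddGroup.rank D := by linarith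
  have hhalf : (Nat.card D : ℝ) ^ (1 / 2 : ℝ) = Nat.card Lag := by
    rw [rpow_card_half hq hLag, Real.rpow_one]
  have hx0 : 0 ≤ lam * Nat.card Lag := mul_nonneg hlam₀ hL.le
  have hx1 : lam * Nat.card Lag < 1 := by
    rwa [← neg_div, rpow_card_half hq hLag, Real.rpow_neg_one, ← one_div, lt_div_iff₀ hL] at hlam
  set K : ℝ := (Nat.card Lag : ℝ) ^ g * (Nat.card Lag : ℝ)⁻¹ with hKdef
  have hK0 : 0 ≤ K := by positivity
  have hK : (Nat.card D : ℝ) ^ (((g : ℝ) - 1) / 2) = K := by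
    rw [rpow_card_half hq hLag, Real.rpow_sub_one hL.ne', Real.rpow_natCast, div_eq_mul_inv]
  -- a summable majorant for the contribution of each class
  set B : PairClass → ℝ := fun P => C * K * ((lam * Nat.card Lag) ^ (rep P).rank *
    (Nat.card (rep P).Tor : ℝ) ^ (-(s - AddGroup.rank D))) with hB
  obtain ⟨hBs, hBle⟩ := summable_pairClass hrep hx0 hx1 hσ
  replace hBs : Summable B := hBs.mul_left _
  choose M hM hMle using fun P => exists_hasSum_of_tsum_le
    (mul_nonneg (mul_nonneg hC.le (pow_nonneg hlam₀ _)) (Real.rpow_nonneg (Nat.cast_nonneg _) _))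
    (hμ P)
  have hMB : ∀ P, M P * (K * Nat.card (rep P →ₗ[ℤ] (Lag →ₗ[ℤ] QZ))) ≤ B P := fun P =>
    (mul_le_mul_of_nonneg_right (hMle P) (by positivity)).trans
      (weight_mul_card_hom_le (rep P) hC hlam₀ hK0)
  have hmaj : ∀ P, HasSum (fun f => (μ P f : ℝ) * (K * Nat.card (rep P →ₗ[ℤ] (Lag →ₗ[ℤ] QZ))))
      (M P * (K * Nat.card (rep P →ₗ[ℤ] (Lag →ₗ[ℤ] QZ)))) := fun P => (hM P).mul_right _
  have hnorm : ∀ P, Summable fun f => ‖summand q Lag (rep P) f (μ P f)‖ := fun P =>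
    (hmaj P).summable.of_nonneg_of_le (fun f => norm_nonneg _)
      fun f => norm_summand_le hq hLag f _
  have hnormle : ∀ P, ∑' f, ‖summand q Lag (rep P) f (μ P f)‖ ≤ B P := fun P =>
    (((hnorm P).tsum_le_tsum (fun f => norm_summand_le hq hLag f _) (hmaj P).summable).trans_eq
      (hmaj P).tsum_eq).trans (hMB P)
  refine ⟨fun X k f c => ⟨fun S => S.value_eq_partitionFunction hq hLag c,
    partitionFunction_eq_theta hq hLag f c⟩, (hasSum_XiTerm hσ).summable, ?_, ?_, ?_⟩
  · refine Summable.of_norm ((summable_sigma_of_nonneg fun t => norm_nonneg _).2 ⟨hnorm, ?_⟩)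
    exact hBs.of_nonneg_of_le (fun P => tsum_nonneg fun f => norm_nonneg _) hnormle
  · have hPle : ∀ P, ‖∑' f, summand q Lag (rep P) f (μ P f)‖ ≤ B P := fun P =>
      (norm_tsum_le_tsum_norm (hnorm P)).trans (hnormle P)
    have hPs := hBs.of_nonneg_of_le (fun P => norm_nonneg _) hPle
    calc ‖connectedZ q Lag g rep μ‖ ≤ ∑' P, B P :=
          (norm_tsum_le_tsum_norm hPs).trans (hPs.tsum_le_tsum hPle hBs)
      _ ≤ C * K * (Xi (s - AddGroup.rank D) / (1 - lam * Nat.card Lag)) := by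
          rw [hB, tsum_mul_left]
          exact mul_le_mul_of_nonneg_left hBle (by positivity)
      _ = _ := by rw [hK, hhalf, mul_div_assoc]
  intro μ₀ ν hfac hν
  choose hrow hrows hrowle using fun P => hasSum_dirichletTerm hq hLag (hM P) (hfac P) (hν P)
  have hdouble := summable_prod_of_row_bound hBs hrows fun P => (hrowle P).trans (hMB P)
  -- The double series over pairs and integers is summed by rows and by columns.
  have hcol : ∀ n : ℕ, ∑' P, dirichletTerm q Lag (rep P) (μ₀ P) (ν P) n * (n : ℂ) ^ g
      = dirichletCoeff q Lag rep μ₀ ν n * (n : ℂ) ^ g := fun n => tsum_mul_right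
  have hnat : HasSum (fun n : ℕ => dirichletCoeff q Lag rep μ₀ ν n * (n : ℂ) ^ g)
      (connectedZ q Lag g rep μ) := by
    have hZ : ∑' t : PairClass × ℕ, dirichletTerm q Lag (rep t.1) (μ₀ t.1) (ν t.1) t.2
        * (t.2 : ℂ) ^ g = connectedZ q Lag g rep μ :=
      (hdouble.tsum_prod' fun P => (hrow P).summable).trans
        (tsum_congr fun P => (hrow P).tsum_eq)
    have hswap := hdouble.prod_symm
    simp only [← hcol, ← hZ, ← (Equiv.prodComm ℕ PairClass).tsum_eq]
    exact hswap.hasSum.prod_fiberwise fun n => (hswap.prod_factor n).hasSum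
  have hdvd : ∀ (P : PairClass) (n : ℕ), (∀ α : rep P →ₗ[ℤ] (Lag →ₗ[ℤ] QZ),
      (∑' φ : LinearMap.ker α, ν P φ) * (Nat.card Lag : ℝ) ≠ n) →
      dirichletTerm q Lag (rep P) (μ₀ P) (ν P) n = 0 := by
    intro P n h
    rw [dirichletTerm_eq hq hLag]
    exact Finset.sum_eq_zero fun α _ => if_neg (h α)
  refine ⟨fun n hn => ?_, fun n hn => ?_, hnat, fun h => ?_⟩
  -- For `n ≥ 1` the factor `n ^ g` can be cancelled in the column of `n`.
  · have hn' : (n : ℂ) ^ g ≠ 0 := pow_ne_zero _ (by exact_mod_cast (by omega : n ≠ 0))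
    exact (summable_mul_right_iff hn').1 (hdouble.prod_symm.prod_factor n)
  · rw [dirichletCoeff]
    refine (tsum_congr fun P => hdvd P n fun α hα => hn ?_).trans tsum_zero
    obtain ⟨-, _, -, hker⟩ := exists_kernel_weight Lag (hν P)
    obtain ⟨N, hN, hdiv, -⟩ := hker α
    rwa [← Nat.cast_injective (R := ℝ) (hN.symm.trans hα)]
  · refine (PNat.coe_injective.hasSum_iff (f := fun n : ℕ =>
      dirichletCoeff q Lag rep μ₀ ν n * (n : ℂ) ^ g) fun n hn => ?_).2 hnat
    obtain rfl : n = 0 := by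
      by_contra h0
      exact hn ⟨⟨n, Nat.pos_of_ne_zero h0⟩, rfl⟩
    -- The term of `n = 0` vanishes: either `0 ^ g = 0`, or no `α` has weight zero on its kernel.
    rcases h with hg | hker
    · simp [Nat.one_le_iff_ne_zero.1 hg]
    · have h0 : dirichletCoeff q Lag rep μ₀ ν 0 = 0 := by
        refine (tsum_congr fun P => hdvd P 0 fun α => ?_).trans tsum_zero
        rw [Nat.cast_zero]
        exact mul_ne_zero (hker P α) hL.ne'
      simp [h0]
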